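/- Let $M$ be a smooth manifold of dimension $m$ and let $\mathcal I\subset\Omega^\bullet(M)$ be an exterior differential system: a homogeneous, differentially closed ideal with $\mathcal I_0=0$ whose graded pieces $\mathcal I_d=\mathcal I\cap\Omega^d(M)$ are finitely generated $C^\infty(M)$-modules. An $n$-plane $e\subset T_pM$ is an integral element if $\varphi|_e=0$ for all $\varphi\in\mathcal I_n$; $\mathrm{Var}_n(\mathcal I)\subset\mathrm{Gr}_n(TM)$ denotes the set of integral elements (on which, if an independence condition $\boldsymbol\omega\in\Omega^n(M)$ is specified, $\boldsymbol\omega|_e\neq0$ is also required). An element $e$ of $\mathrm{Var}_n(\mathcal I)$ is Kähler-ordinary if near $e$ the set $\mathrm{Var}_n(\mathcal I)$ is the common zero set in $\mathrm{Gr}_n(TM)$ of finitely many forms of $\mathcal I_n$ whose coefficient functions have linearly independent differentials at $e$, and Kähler-regular if moreover the Cartan characters of the tableaux (the tangent spaces of the fibers over $M$ of the set of Kähler-ordinary elements, as subspaces of $(T_pM/e)\otimes e^*$) are constant near $e$. Let $M^{(1)}$ be a connected component of the set of Kähler-regular integral elements, such that the projection $M^{(1)}\to M$ is a smooth bundle (it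 is enough that $M^{(1)}$ has a smooth local section over $M$ through each of its elements). For $e\in M^{(1)}$ over $p\in M$ let $A_e=T_e(M^{(1)}\cap\mathrm{Gr}_n(T_pM))\subset T_e\mathrm{Gr}_n(T_pM)=(T_pM/e)\otimes e^*$ be the tableau at $e$. Fix $e\in M^{(1)}$. (1) Let $0\neq\xi\in e^*$, let $e'=\ker\xi$, and let $\tilde e\subset T_pM$ be an $n$-dimensional integral element of $\mathcal I$ of the form $\tilde e=e'+\langle w\rangle$ (no independence condition is required of $\tilde e$, nor that $\tilde e\in M^{(1)}$). Then $w\otimes\xi\in A_e$ (where $w$ also denotes its class in $T_pM/e$). If moreover $\tilde e\neq e$, then the polar pair $(e,\tilde e)$ represents $[w\otimes\xi]$, and there are $\varepsilon>0$ and a continuous injective family $(e_t)_{-\varepsilon<t<\varepsilon}$ of integral elements $e_t\in M^{(1)}\cap\mathrm{Gr}_n(T_pM)$ containing $e'$, with $e_0=e$, smooth at $t=0$ with velocity $w\otimes\xi\in T_e\mathrm{Gr}_n(T_pM)$, such that for every $t\neq0$ the polar pair $(e,e_t)$ represents $[w\otimes\xi]$. Here a plane $f$ is said to represent $[w\otimes\xi]$,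 with $w\notin e$, if $f\cap e=\ker\xi$ and $f/e$, the image of $f$ in $T_pM/e$, is the line spanned by the class of $w$. (2) For a complex hyperplane $e'=\ker\xi\subset e\otimes\mathbb C$, $0\ne\xi\in e^*\otimes\mathbb C$, let $H(e')=\{v\in T_pM\otimes\mathbb C:\varphi|_{e'+\langle v\rangle}=0\ \text{for all}\ \varphi\in\mathcal I_n\}$ be its polar space and $r(e')=\dim_{\mathbb C}H(e')-\dim_{\mathbb C}e'-1$ its polar rank. Then for every nonzero $\xi\in e^*\otimes\mathbb C$ one has $$\{w\in(T_pM/e)\otimes\mathbb C:\ w\otimes\xi\in A_e\otimes\mathbb C\}=H(\ker\xi)/(e\otimes\mathbb C),$$ and this space has dimension $r(\ker\xi)$. Consequently the characteristic variety $\Xi_e=\{[\xi]:r(\ker\xi)>0\}$ is, as a set, the projection to $\mathbb P(e^*\otimes\mathbb C)$ of the rank-one cone $\{w\otimes\xi\in A_e\otimes\mathbb C\}$ (without its vertex $0$), and the fiber of that cone over $[\xi]$ is given by $H(\ker\xi)/(e\otimes\mathbb C)$. -/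

import Mathlib

open scoped Manifold ContDiff Topology TensorProduct

noncomputable section

namespace EDS

/-! ## Differential forms and exterior differential systems on a smooth manifold

Throughout, `M` is a manifold modelled on `ℝ^m`, i.e. on `EuclideanSpace ℝ (Fin m)` with the model
with corners `𝓡 m` (no boundary); `TangentSpace (𝓡 m) p` is the tangent space `T_p M`. -/

/-- The model space `ℝ^m`. -/
abbrev Model (m : ℕ) : Type := EuclideanSpace ℝ (Fin m)

section Forms

variable {m : ℕ} {M : Type*} [TopologicalSpace M] [ChartedSpace (Model m) M]

variable (m M) in
/-- Fields of alternating `k`-forms on the tangent spaces of `M` (no regularity). -/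
abbrev FormField (k : ℕ) : Type _ :=
  ∀ p : M, TangentSpace (𝓡 m) p [⋀^Fin k]→L[ℝ] ℝ

/-- The expression of a field of forms in the preferred chart at `q`: its pull-back by the inverse
of the chart, as a form-valued function on `ℝ^m` (meaningful on the target of the chart). -/
def FormField.inChart {k : ℕ} (φ : FormField m M k) (q : M) (x : Model m) :
    Model m [⋀^Fin k]→L[ℝ] ℝ :=
  (φ ((extChartAt (𝓡 m) q).symm x)).compContinuousLinearMap
    (mfderiv 𝓘(ℝ, Model m) (𝓡 m) (extChartAt (𝓡 m) q).symm x)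

/-- A smooth differential form. -/
def FormField.IsSmooth {k : ℕ} (φ : FormField m M k) : Prop :=
  ∀ q : M, ContDiffOn ℝ ∞ (φ.inChart q) (extChartAt (𝓡 m) q).target

/-- The exterior derivative of a form, computed at `p` in the preferred chart at `p`. -/
def FormField.d {k : ℕ} (φ : FormField m M k) : FormField m M (k + 1) := fun p =>
  (extDeriv (φ.inChart p) (extChartAt (𝓡 m) p p)).compContinuousLinearMap
    (mfderiv (𝓡 m) 𝓘(ℝ, Model m) (extChartAt (𝓡 m) p) p)

/-- The exterior product of two alternating forms on a vector space. -/
def wedge {X : Type*} [AddCommGroup X] [Module ℝ X] {k l : ℕ}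
    (α : X [⋀^Fin k]→ₗ[ℝ] ℝ) (β : X [⋀^Fin l]→ₗ[ℝ] ℝ) : X [⋀^Fin (k + l)]→ₗ[ℝ] ℝ :=
  ((LinearMap.mul' ℝ ℝ).compAlternatingMap (α.domCoprod β)).domDomCongr finSumFinEquiv

variable (m M) in
/-- An exterior differential system on `M`: a (homogeneous) ideal in the exterior algebra of smooth
differential forms, given by its graded pieces, which contains no nonzero function, is closed under
the exterior derivative, and is finitely generated over `C^∞(M)` in each degree. -/
structure System where
  /-- The forms of degree `k` in the ideal. -/
  forms : ∀ k : ℕ, Set (FormField m M k)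
  smooth : ∀ k, ∀ φ ∈ forms k, φ.IsSmooth
  zero_mem : ∀ k, (0 : FormField m M k) ∈ forms k
  add_mem : ∀ k, ∀ φ ∈ forms k, ∀ ψ ∈ forms k, φ + ψ ∈ forms k
  wedge_mem : ∀ k l, ∀ φ ∈ forms k, ∀ ψ : FormField m M l, ψ.IsSmooth →
    ∀ χ : FormField m M (k + l),
      (∀ p, (χ p).toAlternatingMap = wedge (φ p).toAlternatingMap (ψ p).toAlternatingMap) →
      χ ∈ forms (k + l)
  d_mem : ∀ k, ∀ φ ∈ forms k, φ.d ∈ forms (k + 1)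
  finitely_generated : ∀ k, ∃ (N : ℕ) (g : Fin N → FormField m M k), (∀ j, g j ∈ forms k) ∧
    ∀ φ ∈ forms k, ∃ f : Fin N → M → ℝ, (∀ j, ContMDiff (𝓡 m) 𝓘(ℝ, ℝ) ∞ (f j)) ∧
      ∀ p, φ p = ∑ j, f j p • g j p
  forms_zero : forms 0 = {0}

end Forms

/-! ## The Grassmann bundle -/

section Grassmann

variable (m n : ℕ) (M : Type*) [TopologicalSpace M] [ChartedSpace (Model m) M]

/-- The total space of the bundle `Gr_n(TM)` of `n`-planes tangent to `M`. -/
@[ext]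
structure Gr where
  /-- The base point `p`. -/
  base : M
  /-- The `n`-plane `e ⊆ T_p M`. -/
  plane : Submodule ℝ (TangentSpace (𝓡 m) base)
  finrank_plane : Module.finrank ℝ plane = n

/-- The bundle of `n`-frames (linearly independent `n`-tuples of tangent vectors at one point). -/
structure Frame where
  /-- The base point. -/
  base : M
  /-- The vectors of the frame. -/
  vec : Fin n → TangentSpace (𝓡 m) base
  linearIndependent : LinearIndependent ℝ vec

variable {m n M}

/-- The plane spanned by a frame. -/
def Frame.toGr (b : Frame m n M) : Gr m n M where
  base := b.base
  plane := Submodule.span ℝ (Set.range b.vec)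
  finrank_plane := by
    rw [finrank_span_eq_card b.linearIndependent, Fintype.card_fin]

variable (m n) in
/-- The Grassmannian `Gr_n(T_p M)`, the fiber of `Gr_n(TM)` over `p`. -/
abbrev GrFiber (p : M) : Type :=
  {P : Submodule ℝ (TangentSpace (𝓡 m) p) // Module.finrank ℝ P = n}

/-- The inclusion of the fiber `Gr_n(T_p M)` in `Gr_n(TM)`. -/
def GrFiber.toGr {p : M} (P : GrFiber m n p) : Gr m n M := ⟨p, P.1, P.2⟩

/-- A vector of `ℝ^m`, viewed in `T_p M` (through the identification of `T_p M` with `ℝ^m` by the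
preferred chart at `p`, which in Mathlib is definitional). -/
def toTangent (p : M) : Model m ≃ₗ[ℝ] TangentSpace (𝓡 m) p :=
  LinearEquiv.refl ℝ (Model m)

/-- The subspace of `T_p M` spanned by an `n`-tuple of vectors. -/
def spanAt (p : M) (u : Fin n → Model m) : Submodule ℝ (TangentSpace (𝓡 m) p) :=
  Submodule.span ℝ (Set.range fun i => toTangent p (u i))

/-- The curve `γ` in `Gr_n(T_p M)` is smooth at time `0`, passes through `e` at time `0`, and its
velocity there is `K ∈ Hom(e, T_p M / e) = T_e Gr_n(T_p M)`: the curve is spanned, near `0`, by a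
smooth moving frame `u` with `K (u_i(0)) = u_i'(0) mod e`. -/
def HasVelocity (e : Gr m n M) (γ : ℝ → GrFiber m n e.base)
    (K : e.plane →ₗ[ℝ] (TangentSpace (𝓡 m) e.base ⧸ e.plane)) : Prop :=
  (γ 0).1 = e.plane ∧
  ∃ u : ℝ → Fin n → Model m, ContDiffAt ℝ ∞ u 0 ∧
    (∀ᶠ t in 𝓝 (0 : ℝ), (γ t).1 = spanAt e.base (u t)) ∧
    ∀ (i : Fin n) (hi : toTangent e.base (u 0 i) ∈ e.plane),
      K ⟨toTangent e.base (u 0 i), hi⟩ = e.plane.mkQ (toTangent e.base (deriv u 0 i))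

/-- The tableau at `e` of a subset `S` of `Gr_n(TM)`: the tangent space at `e` of the fiber
`S ∩ Gr_n(T_p M)`, i.e. the space (spanned by) the velocities of the smooth curves in that fiber
that pass through `e`, as a subspace of `Hom(e, T_p M / e)`. -/
def tableau (S : Set (Gr m n M)) (e : Gr m n M) :
    Submodule ℝ (e.plane →ₗ[ℝ] (TangentSpace (𝓡 m) e.base ⧸ e.plane)) :=
  Submodule.span ℝ {K | ∃ γ : ℝ → GrFiber m n e.base,
    HasVelocity e γ K ∧ ∀ᶠ t in 𝓝 (0 : ℝ), (γ t).toGr ∈ S}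

variable [IsManifold (𝓡 m) ∞ M]

/-- The frame bundle has the topology of a subspace of `M × (TM)^n`. -/
instance : TopologicalSpace (Frame m n M) :=
  TopologicalSpace.induced
    (fun b => ((b.base, fun i => ⟨b.base, b.vec i⟩) : M × (Fin n → TangentBundle (𝓡 m) M)))
    inferInstance

/-- `Gr_n(TM)` is topologized as the quotient of the frame bundle. -/
instance : TopologicalSpace (Gr m n M) :=
  TopologicalSpace.coinduced Frame.toGr inferInstance

end Grassmann

/-! ## Cartan characters of a tableau -/

section Cartan

variable {V W : Type*} [AddCommGroup V] [Module ℝ V] [AddCommGroup W] [Module ℝ W]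

/-- `s_1 + ⋯ + s_k`: the largest number of linearly independent entries in `k` columns of `A`,
over all choices of vectors of `V` that define these columns. -/
def cartanSum (A : Submodule ℝ (V →ₗ[ℝ] W)) (k : ℕ) : ℕ :=
  ⨆ v : Fin k → V,
    Module.finrank ℝ (A.map (LinearMap.pi fun i => LinearMap.applyₗ (v i) :
      (V →ₗ[ℝ] W) →ₗ[ℝ] (Fin k → W)))

/-- The Cartan character `s_{k+1}` of the tableau `A`. -/
def cartanCharacter (A : Submodule ℝ (V →ₗ[ℝ] W)) (k : ℕ) : ℕ :=
  cartanSum A (k + 1) - cartanSum A k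

end Cartan

/-! ## Integral elements, Kähler-regularity, and the first prolongation -/

section Integral

variable {m n : ℕ} {M : Type*} [TopologicalSpace M] [ChartedSpace (Model m) M]

/-- The form `φ` vanishes on the plane `e`. -/
def VanishesOn (φ : FormField m M n) (e : Gr m n M) : Prop :=
  ∀ u : Fin n → TangentSpace (𝓡 m) e.base, (∀ i, u i ∈ e.plane) → φ e.base u = 0

/-- `e` is an integral element of `I`: all `n`-forms of the ideal vanish on `e`. -/
def IsIntegralElement (I : System m M) (e : Gr m n M) : Prop :=
  ∀ φ ∈ I.forms n, VanishesOn φ e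

/-- `Var_n(I)`: the integral elements of `I` that satisfy the independence condition `Ω` (a form
that must not vanish on `e`), if one is specified. -/
def integralVariety (I : System m M) (Ω : Option (FormField m M n)) : Set (Gr m n M) :=
  {e | IsIntegralElement I e ∧ ∀ η ∈ Ω, ¬ VanishesOn η e}

/-- The function `(x, u) ↦ φ_x (u_1, …, u_n)` on frames, in the preferred chart at `q`. -/
def frameFunction (φ : FormField m M n) (q : M) : Model m × (Fin n → Model m) → ℝ :=
  fun z => φ.inChart q z.1 z.2

variable [IsManifold (𝓡 m) ∞ M]

/-- `Var_n^o(I)`, the Kähler-ordinary integral elements: near `e`, the set `Var_n(I)` is cut out in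
`Gr_n(TM)` by finitely many `n`-forms of the ideal whose coefficient functions have linearly
independent differentials at `e`.  (The differentials are taken on the frame bundle, at a basis of
`e`; on the common zero set this is the same as on `Gr_n(TM)`.) -/
def ordinaryVariety (I : System m M) (Ω : Option (FormField m M n)) : Set (Gr m n M) :=
  {e | e ∈ integralVariety I Ω ∧
    ∃ (c : ℕ) (φ : Fin c → FormField m M n), (∀ i, φ i ∈ I.forms n) ∧
      (∃ b : Fin n → TangentSpace (𝓡 m) e.base, Submodule.span ℝ (Set.range b) = e.plane ∧
        LinearIndependent ℝ fun i => fderiv ℝ (frameFunction (φ i) e.base)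
          (extChartAt (𝓡 m) e.base e.base,
            fun j => mfderiv (𝓡 m) 𝓘(ℝ, Model m) (extChartAt (𝓡 m) e.base) e.base (b j))) ∧
      ∃ U : Set (Gr m n M), IsOpen U ∧ e ∈ U ∧
        ∀ f ∈ U, (∀ i, VanishesOn (φ i) f) → f ∈ integralVariety I Ω}

/-- The Kähler-regular integral elements: the Kähler-ordinary ones near which the Cartan characters
of the tableaux of `Var_n^o(I)` are constant. -/
def regularVariety (I : System m M) (Ω : Option (FormField m M n)) : Set (Gr m n M) :=
  {e | e ∈ ordinaryVariety I Ω ∧ ∃ U : Set (Gr m n M), IsOpen U ∧ e ∈ U ∧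
    ∀ f ∈ U ∩ ordinaryVariety I Ω, ∀ k : ℕ,
      cartanCharacter (tableau (ordinaryVariety I Ω) f) k =
        cartanCharacter (tableau (ordinaryVariety I Ω) e) k}

/-- The projection of `S ⊆ Gr_n(TM)` to `M` is a smooth submersion, in the sense that there is a
smooth local section of `S` (spanned by smooth vector fields `σ_1, …, σ_n`) through every element
of `S`.  This holds when `S → M` is a smooth bundle. -/
def HasSmoothLocalSections (S : Set (Gr m n M)) : Prop :=
  ∀ e ∈ S, ∃ σ : Fin n → ∀ q : M, TangentSpace (𝓡 m) q,
    (∀ i, ContMDiffAt (𝓡 m) (𝓡 m).tangent ∞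
      (fun q => (⟨q, σ i q⟩ : TangentBundle (𝓡 m) M)) e.base) ∧
    Submodule.span ℝ (Set.range fun i => σ i e.base) = e.plane ∧
    ∀ᶠ q in 𝓝 e.base, ∃ f : GrFiber m n q,
      f.1 = Submodule.span ℝ (Set.range fun i => σ i q) ∧ f.toGr ∈ S

/-- `M1` is a first prolongation `M^{(1)}` of `(M, I)` (with independence condition `Ω`): a
connected component of the set of Kähler-regular integral elements that projects to `M` as a smooth
bundle. -/
def IsFirstProlongation (I : System m M) (Ω : Option (FormField m M n))
    (M1 : Set (Gr m n M)) : Prop :=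
  (∃ e₀ ∈ regularVariety I Ω, M1 = connectedComponentIn (regularVariety I Ω) e₀) ∧
    HasSmoothLocalSections M1

end Integral

/-! ## Polar pairs -/

/-- For subspaces `e`, `f` of `X`, the polar pair `(e, f)` is represented by the rank-one line
`[K]`, `K ∈ Hom(e, X/e)`: `f / e ⊆ X/e` is the line `im K`, and `f ∩ e` is the hyperplane `ker K`
of `e`. -/
def Represents {X : Type*} [AddCommGroup X] [Module ℝ X] (e f : Submodule ℝ X)
    (K : e →ₗ[ℝ] (X ⧸ e)) : Prop :=
  Module.finrank ℝ (LinearMap.range K) = 1 ∧ f.map e.mkQ = LinearMap.range K ∧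
    f ⊓ e = (LinearMap.ker K).map e.subtype

/-! ## The complex characteristic variety and the rank-one cone -/

section Complex

/-- Real part of a vector of the complexification `ℂ ⊗ X`. -/
def rePart {X : Type*} [AddCommGroup X] [Module ℝ X] : ℂ ⊗[ℝ] X →ₗ[ℝ] X :=
  (TensorProduct.lid ℝ X).toLinearMap ∘ₗ LinearMap.rTensor X Complex.reLm

/-- Imaginary part of a vector of the complexification `ℂ ⊗ X`. -/
def imPart {X : Type*} [AddCommGroup X] [Module ℝ X] : ℂ ⊗[ℝ] X →ₗ[ℝ] X :=
  (TensorProduct.lid ℝ X).toLinearMap ∘ₗ LinearMap.rTensor X Complex.imLm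

/-- The complex multilinear extension of an alternating form, evaluated on `z_j = x_j + i y_j` by
expanding the product. -/
def complexEval {X : Type*} [AddCommGroup X] [Module ℝ X] {n : ℕ} (φ : X [⋀^Fin n]→ₗ[ℝ] ℝ)
    (z : Fin n → ℂ ⊗[ℝ] X) : ℂ :=
  ∑ S : Finset (Fin n),
    Complex.I ^ S.card * (φ (fun j => if j ∈ S then imPart (z j) else rePart (z j)) : ℂ)

variable {m n : ℕ} {M : Type*} [TopologicalSpace M] [ChartedSpace (Model m) M]

variable (n) in
/-- The polar space `H(e')` of a complex subspace `e'` of `ℂ ⊗ T_p M`: all `v` such that the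
(complexified) `n`-forms of the ideal vanish on `e' + ⟨v⟩`. -/
def polarSet (I : System m M) {p : M} (e' : Submodule ℂ (ℂ ⊗[ℝ] TangentSpace (𝓡 m) p)) :
    Set (ℂ ⊗[ℝ] TangentSpace (𝓡 m) p) :=
  {v | ∀ φ ∈ I.forms n, ∀ z : Fin n → ℂ ⊗[ℝ] TangentSpace (𝓡 m) p,
    (∀ j, z j ∈ e' ⊔ Submodule.span ℂ {v}) → complexEval (φ p).toAlternatingMap z = 0}

variable (n) in
/-- The polar rank `r(e') = dim H(e') - dim e' - 1`. -/
def polarRank (I : System m M) {p : M} (e' : Submodule ℂ (ℂ ⊗[ℝ] TangentSpace (𝓡 m) p)) : ℤ :=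
  (Module.finrank ℂ (Submodule.span ℂ (polarSet n I e')) : ℤ) - Module.finrank ℂ e' - 1

/-- The hyperplane `ξ^⊥ = ker ξ ⊆ ℂ ⊗ e`, as a subspace of `ℂ ⊗ X`. -/
def hyperplane {X : Type*} [AddCommGroup X] [Module ℝ X] {e : Submodule ℝ X}
    (ξ : Module.Dual ℂ (ℂ ⊗[ℝ] e)) : Submodule ℂ (ℂ ⊗[ℝ] X) :=
  (LinearMap.ker ξ).map (e.subtype.baseChange ℂ)

/-- The characteristic variety `Ξ_e`, as a cone (without vertex) in `ℂ ⊗ e^*`: the covectors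
`ξ ≠ 0` with `r(ξ^⊥) > 0`. -/
def characteristicVariety (I : System m M) (e : Gr m n M) :
    Set (Module.Dual ℂ (ℂ ⊗[ℝ] e.plane)) :=
  {ξ | ξ ≠ 0 ∧ 0 < polarRank n I (hyperplane ξ)}

/-- The complexification of a tableau `A ⊆ Hom(e, X/e)`. -/
def complexTableau {V W : Type*} [AddCommGroup V] [Module ℝ V] [AddCommGroup W] [Module ℝ W]
    (A : Submodule ℝ (V →ₗ[ℝ] W)) : Submodule ℂ ((ℂ ⊗[ℝ] V) →ₗ[ℂ] (ℂ ⊗[ℝ] W)) :=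
  Submodule.span ℂ {K | ∃ π ∈ A, K = π.baseChange ℂ}

/-- The rank-one cone of a complexified tableau: its elements `w ⊗ ξ`. -/
def rankOneCone {V W : Type*} [AddCommGroup V] [Module ℝ V] [AddCommGroup W] [Module ℝ W]
    (A : Submodule ℝ (V →ₗ[ℝ] W)) : Set ((ℂ ⊗[ℝ] V) →ₗ[ℂ] (ℂ ⊗[ℝ] W)) :=
  {K | K ∈ complexTableau A ∧
    ∃ (w : ℂ ⊗[ℝ] W) (ξ : Module.Dual ℂ (ℂ ⊗[ℝ] V)), K = ξ.smulRight w}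

end Complex

end EDS

end

/-! The rank-one directions `w ⊗ ξ` in the tableau are governed by one computation. Choose a basis
of `e` consisting of a vector on which `ξ` is 1, followed by a basis of `ker ξ`. If `x` moves to `x
+ t ξ(x) w`, only the first basis vector moves, so the value of an `n`-form on the moved basis is
affine in `t`, and its slope is the value on `w` followed by the basis of `ker ξ`. Hence the
linearized equation `φ = 0` holds in the direction `w ⊗ ξ` exactly when `φ` vanishes on `ker ξ +
⟨w⟩` (`vanishes_on_extension_iff`). In that case `φ` vanishes on the whole pencil of sheared planes,
with no higher-order correction (`compLinearMap_add_smulRight_eq_zero`).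

It remains to identify the tableau with the solutions of the linearized equations of all `n`-forms
of the ideal (`IsFirstProlongation.mem_tableau_iff`). A velocity of a curve of integral elements
satisfies them. Conversely, finitely many forms cut out the variety near `e` with independent
differentials. These forms vanish along a local section of `M1` through `e`, so their differentials
remain independent along the fiber over `p`, and the inverse function theorem gives a curve in the
fiber for each solution. Near `e` the planes of the fiber that satisfy the equations are again
Kähler-regular, and connectedness keeps the curve in the component `M1`
(`IsFirstProlongation.exists_curve`). The same argument puts the pencil of sheared planes in `M1`.

Over the complex numbers, a map lies in the complexified tableau exactly when its real and imaginary
parts lie in the tableau, and the complex linearized equation splits in the same way. So the polar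
space of `ker ξ` is the full preimage of the fiber of the rank-one cone
(`IsFirstProlongation.polarSet_eq`), and the polar rank and the characteristic variety follow by
counting dimensions. -/

noncomputable section

namespace EDS

/-! ### Linearization of a top-degree form in a rank-one direction -/

section Alternating

variable {k V X : Type*} [Field k] [AddCommGroup V] [Module k V] [AddCommGroup X] [Module k X]
  {n : ℕ}

/-- The derivative at `ι` in the direction `L` of the pull-back of an alternating form by linear
maps. -/
def formDeriv (Ψ : X [⋀^Fin (n + 1)]→ₗ[k] k) (ι L : V →ₗ[k] X) : V [⋀^Fin (n + 1)]→ₗ[k] k :=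
  -- Alternatization makes the derivative an alternating form in the basis vectors, so that its
  -- vanishing can be tested on a single basis.
  AlternatingMap.alternatizeUncurryFin
    { toFun := fun x => (Ψ.curryLeft (L x)).compLinearMap ι
      map_add' := fun x y => by ext; simp
      map_smul' := fun c x => by ext; simp }

theorem formDeriv_apply (Ψ : X [⋀^Fin (n + 1)]→ₗ[k] k) (ι L : V →ₗ[k] X) (u : Fin (n + 1) → V) :
    formDeriv Ψ ι L u = ∑ i, Ψ (Function.update (fun j => ι (u j)) i (L (u i))) := by
  rw [formDeriv, AlternatingMap.alternatizeUncurryFin_apply]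
  refine Finset.sum_congr rfl fun i _ => ?_
  rw [← Fin.insertNth_removeNth, AlternatingMap.map_insertNth]
  rfl

theorem exists_adapted_basis (hV : Module.finrank k V = n + 1) {ξ : Module.Dual k V} (hξ : ξ ≠ 0) :
    ∃ f : Module.Basis (Fin (n + 1)) k V, ξ (f 0) = 1 ∧ ∀ i : Fin n, ξ (f i.succ) = 0 := by
  have : FiniteDimensional k V := FiniteDimensional.of_finrank_pos (by omega)
  obtain ⟨v, hv⟩ : ∃ v, ξ v = 1 := LinearMap.surjective hξ 1
  have hker : Module.finrank k (LinearMap.ker ξ) = n := by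
    have h := ξ.finrank_range_add_finrank_ker
    rw [LinearMap.range_eq_top.2 (LinearMap.surjective hξ), finrank_top, Module.finrank_self] at h
    omega
  refine ⟨Module.Basis.mkFinCons v (Module.finBasisOfFinrankEq k (LinearMap.ker ξ) hker) ?_ ?_,
    ?_, fun i => ?_⟩
  · intro c x hx h
    have := congrArg ξ h
    rw [map_add, map_smul, hv, LinearMap.mem_ker.1 hx] at this
    simpa using this
  · intro z
    exact ⟨-ξ z, by simp [LinearMap.mem_ker, hv]⟩
  · simp [hv]
  · simp

/-- Forms of top degree are multiples of a determinant. This reduces every vanishing statement below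
to one evaluation. -/
theorem alternating_eq_zero_of_basis {ι : Type*} [Fintype ι] [DecidableEq ι] {G : V [⋀^ι]→ₗ[k] k}
    (b : Module.Basis ι k V) (h : G b = 0) : G = 0 := by
  rw [G.eq_smul_basis_det b, h, zero_smul]

/-- In a basis adapted to `ξ`, the map `w ⊗ ξ` kills all basis vectors but the first, and one term
of the Leibniz sum survives. -/
theorem formDeriv_smulRight_adapted (Ψ : X [⋀^Fin (n + 1)]→ₗ[k] k) (ι : V →ₗ[k] X)
    {ξ : Module.Dual k V} {f : Fin (n + 1) → V} (h0 : ξ (f 0) = 1)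
    (hs : ∀ i : Fin n, ξ (f i.succ) = 0) (w : X) :
    formDeriv Ψ ι (ξ.smulRight w) f = Ψ (Function.update (fun j => ι (f j)) 0 w) := by
  rw [formDeriv_apply, Fin.sum_univ_succ, Finset.sum_eq_zero, add_zero]
  · simp [h0]
  · intro i _
    rw [LinearMap.smulRight_apply, hs, zero_smul, AlternatingMap.map_update_zero]

/-- A form that vanishes on `ι V` vanishes on `ι (ker ξ) + ⟨w⟩` if and only if its derivative in
the direction `w ⊗ ξ` is zero. -/
theorem vanishes_on_extension_iff (hV : Module.finrank k V = n + 1) (Ψ : X [⋀^Fin (n + 1)]→ₗ[k] k)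
    (ι : V →ₗ[k] X) {ξ : Module.Dual k V} (hξ : ξ ≠ 0) (w : X) :
    (∀ z : Fin (n + 1) → X, (∀ j, z j ∈ (LinearMap.ker ξ).map ι ⊔ Submodule.span k {w}) →
      Ψ z = 0) ↔ formDeriv Ψ ι (ξ.smulRight w) = 0 := by
  obtain ⟨f, h0, hs⟩ := exists_adapted_basis hV hξ
  constructor
  · intro h
    refine alternating_eq_zero_of_basis f ?_
    rw [formDeriv_smulRight_adapted Ψ ι h0 hs]
    refine h _ fun j => ?_
    refine Fin.cases ?_ (fun i => ?_) j
    · rw [Function.update_self]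
      exact Submodule.mem_sup_right (Submodule.mem_span_singleton_self w)
    · rw [Function.update_of_ne (Fin.succ_ne_zero i)]
      exact Submodule.mem_sup_left (Submodule.mem_map_of_mem (LinearMap.mem_ker.2 (hs i)))
  · intro h z hz
    have hval := formDeriv_smulRight_adapted Ψ ι h0 hs w
    rw [h, AlternatingMap.zero_apply] at hval
    -- `T` agrees with `ι` on `ker ξ` and sends `f 0` to `w`, so its range is the extended plane,
    -- and the pull-back of `Ψ` by `T` is tested on the basis `f`. Nothing requires `T` to be
    -- injective.
    let T : V →ₗ[k] X := ι ∘ₗ (LinearMap.id - ξ.smulRight (f 0)) + ξ.smulRight w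
    have hT : Ψ.compLinearMap T = 0 := by
      refine alternating_eq_zero_of_basis f ?_
      rw [AlternatingMap.compLinearMap_apply]
      convert hval.symm using 2
      funext j
      refine Fin.cases ?_ (fun i => ?_) j
      · simp [T, h0]
      · simp [T, hs]
    have hy : ∀ j, ∃ y, T y = z j := by
      intro j
      obtain ⟨_, ⟨x, hx, rfl⟩, _, hw, hxw⟩ := Submodule.mem_sup.1 (hz j)
      obtain ⟨a, rfl⟩ := Submodule.mem_span_singleton.1 hw
      refine ⟨x + a • f 0, ?_⟩
      have hx : ξ x = 0 := hx
      simp [T, ← hxw, hx, h0]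
    choose y hy using hy
    rw [← funext hy]
    exact DFunLike.congr_fun hT y

/-- The parameter `t` enters a single argument of `Ψ`, so the pull-back is affine in `t`; its value
at 0 and its slope both vanish. -/
theorem compLinearMap_add_smulRight_eq_zero (hV : Module.finrank k V = n + 1)
    {Ψ : X [⋀^Fin (n + 1)]→ₗ[k] k} {ι : V →ₗ[k] X} (hι : Ψ.compLinearMap ι = 0)
    {ξ : Module.Dual k V} (hξ : ξ ≠ 0) {w : X} (hw : formDeriv Ψ ι (ξ.smulRight w) = 0) (t : k) :
    Ψ.compLinearMap (ι + t • ξ.smulRight w) = 0 := by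
  obtain ⟨f, h0, hs⟩ := exists_adapted_basis hV hξ
  refine alternating_eq_zero_of_basis f ?_
  have hval := formDeriv_smulRight_adapted Ψ ι h0 hs w
  rw [hw, AlternatingMap.zero_apply] at hval
  have h1 : (fun j => (ι + t • ξ.smulRight w) (f j)) =
      Function.update (fun j => ι (f j)) 0 (ι (f 0) + t • w) := by
    funext j
    refine Fin.cases ?_ (fun i => ?_) j
    · simp [h0]
    · simp [hs]
  rw [AlternatingMap.compLinearMap_apply, h1, AlternatingMap.map_update_add,
    AlternatingMap.map_update_smul, ← hval, Function.update_eq_self, smul_zero, add_zero]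
  exact DFunLike.congr_fun hι (f : Fin (n + 1) → V)

end Alternating

/-! ### Complexified vectors and forms -/

section Complexification

variable {X : Type*} [AddCommGroup X] [Module ℝ X]

@[simp]
theorem rePart_tmul (z : ℂ) (x : X) : rePart (z ⊗ₜ[ℝ] x) = z.re • x := by
  simp [rePart]

@[simp]
theorem imPart_tmul (z : ℂ) (x : X) : imPart (z ⊗ₜ[ℝ] x) = z.im • x := by
  simp [imPart]

theorem tmul_rePart_add_imPart (z : ℂ ⊗[ℝ] X) :
    (1 : ℂ) ⊗ₜ[ℝ] rePart z + Complex.I • ((1 : ℂ) ⊗ₜ[ℝ] imPart z) = z := by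
  induction z with
  | zero => simp
  | add a b ha hb =>
    rw [map_add, map_add, TensorProduct.tmul_add, TensorProduct.tmul_add, smul_add]
    nth_rewrite 3 [← ha]
    nth_rewrite 3 [← hb]
    abel
  | tmul z x =>
    rw [rePart_tmul, imPart_tmul, TensorProduct.smul_tmul', ← TensorProduct.smul_tmul,
      ← TensorProduct.smul_tmul, ← TensorProduct.add_tmul]
    congr 1
    apply Complex.ext <;> simp

theorem rePart_smul (c : ℂ) (z : ℂ ⊗[ℝ] X) :
    rePart (c • z) = c.re • rePart z - c.im • imPart z := by
  induction z with
  | zero => simp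
  | add a b ha hb => rw [smul_add, map_add, ha, hb, map_add, map_add]; module
  | tmul z x => simp [TensorProduct.smul_tmul', sub_smul, mul_smul]

theorem imPart_smul (c : ℂ) (z : ℂ ⊗[ℝ] X) :
    imPart (c • z) = c.re • imPart z + c.im • rePart z := by
  induction z with
  | zero => simp
  | add a b ha hb => rw [smul_add, map_add, ha, hb, map_add, map_add]; module
  | tmul z x => simp [TensorProduct.smul_tmul', add_smul, mul_smul]

/-- Multilinear expansion in real and imaginary parts shows that the complex extension is unique, so
any construction of it may be used. -/
theorem complexEval_eq_of_extends {n : ℕ} (φ : X [⋀^Fin n]→ₗ[ℝ] ℝ)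
    (Φ : MultilinearMap ℂ (fun _ : Fin n => ℂ ⊗[ℝ] X) ℂ)
    (h : ∀ x : Fin n → X, Φ (fun j => (1 : ℂ) ⊗ₜ[ℝ] x j) = φ x) (z : Fin n → ℂ ⊗[ℝ] X) :
    Φ z = complexEval φ z := by
  have hz : z = (fun j => Complex.I • ((1 : ℂ) ⊗ₜ[ℝ] imPart (z j))) +
      fun j => (1 : ℂ) ⊗ₜ[ℝ] rePart (z j) := by
    funext j
    rw [Pi.add_apply, add_comm, tmul_rePart_add_imPart]
  conv_lhs => rw [hz, MultilinearMap.map_add_univ]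
  refine Finset.sum_congr rfl fun S _ => ?_
  have h1 : (S.piecewise (fun j => Complex.I • ((1 : ℂ) ⊗ₜ[ℝ] imPart (z j)))
      fun j => (1 : ℂ) ⊗ₜ[ℝ] rePart (z j)) =
      S.piecewise (fun i => (fun _ => Complex.I) i •
        (fun j => (1 : ℂ) ⊗ₜ[ℝ] (if j ∈ S then imPart (z j) else rePart (z j))) i)
        (fun j => (1 : ℂ) ⊗ₜ[ℝ] (if j ∈ S then imPart (z j) else rePart (z j))) := by
    funext j
    by_cases hj : j ∈ S <;> simp [hj]
  rw [h1, MultilinearMap.map_piecewise_smul, h, Finset.prod_const, smul_eq_mul]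

/-- The complex multilinear extension of an alternating form is an alternating form. -/
theorem exists_alternatingMap_eq_complexEval [FiniteDimensional ℝ X] {n : ℕ}
    (φ : X [⋀^Fin n]→ₗ[ℝ] ℝ) :
    ∃ Φ : (ℂ ⊗[ℝ] X) [⋀^Fin n]→ₗ[ℂ] ℂ, (∀ z, Φ z = complexEval φ z) ∧
      ∀ x : Fin n → X, Φ (fun j => (1 : ℂ) ⊗ₜ[ℝ] x j) = φ x := by
  classical
  let B := Module.finBasis ℝ X
  let d := Module.finrank ℝ X
  let c : Fin d → (ℂ ⊗[ℝ] X →ₗ[ℂ] ℂ) := fun i => (B.baseChange ℂ).coord i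
  have hc : ∀ i x, c i ((1 : ℂ) ⊗ₜ[ℝ] x) = (B.repr x i : ℂ) := by
    intro i x
    simp [c]
  -- The extension is written in coordinates of a real basis, as a sum over multi-indices `J`.
  let Φ : MultilinearMap ℂ (fun _ : Fin n => ℂ ⊗[ℝ] X) ℂ :=
    ∑ J : Fin n → Fin d, (φ (fun j => B (J j)) : ℂ) •
      (MultilinearMap.mkPiAlgebra ℂ (Fin n) ℂ).compLinearMap fun j => c (J j)
  have hΦ : ∀ z, Φ z = ∑ J : Fin n → Fin d, (φ (fun j => B (J j)) : ℂ) * ∏ j, c (J j) (z j) := by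
    intro z
    simp [Φ]
  have hext : ∀ x : Fin n → X, Φ (fun j => (1 : ℂ) ⊗ₜ[ℝ] x j) = φ x := by
    intro x
    have hx : φ x = ∑ J : Fin n → Fin d, (∏ j, B.repr (x j) (J j)) * φ (fun j => B (J j)) := by
      conv_lhs => rw [show x = fun j => ∑ i, B.repr (x j) i • B i from
        funext fun j => (B.sum_repr (x j)).symm]
      rw [← AlternatingMap.coe_multilinearMap, MultilinearMap.map_sum]
      refine Finset.sum_congr rfl fun J _ => ?_
      rw [MultilinearMap.map_smul_univ, smul_eq_mul]
    rw [hΦ, hx]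
    push_cast
    refine Finset.sum_congr rfl fun J _ => ?_
    rw [mul_comm]
    simp [hc]
  refine ⟨⟨Φ, ?_⟩, complexEval_eq_of_extends φ Φ hext, hext⟩
  intro z i j hij hne
  change Φ z = 0
  rw [hΦ]
  -- When `z i = z j`, exchanging the entries `i` and `j` of `J` changes the sign of the term. A
  -- multi-index fixed by the exchange repeats a basis vector, so its term is zero.
  refine Finset.sum_involution (fun J _ => J ∘ Equiv.swap i j) ?_ ?_ (fun _ _ => Finset.mem_univ _)
    ?_
  · intro J _
    have h1 : φ (fun l => B ((J ∘ Equiv.swap i j) l)) = -φ (fun l => B (J l)) :=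
      φ.map_swap (fun l => B (J l)) hne
    have h2 : ∏ l, c ((J ∘ Equiv.swap i j) l) (z l) = ∏ l, c (J l) (z l) := by
      rw [← Equiv.prod_comp (Equiv.swap i j) fun l => c (J l) (z l)]
      refine Finset.prod_congr rfl fun l _ => ?_
      have : z (Equiv.swap i j l) = z l := by
        by_cases hi : l = i
        · rw [hi, Equiv.swap_apply_left, hij]
        by_cases hj : l = j
        · rw [hj, Equiv.swap_apply_right, hij]
        rw [Equiv.swap_apply_of_ne_of_ne hi hj]
      rw [Function.comp_apply, this]
    rw [h1, h2]
    push_cast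
    ring
  · intro J _ h hJ
    apply h
    have hJij : J i = J j := by
      have := congrFun hJ j
      simpa using this
    rw [φ.map_eq_zero_of_eq _ (congrArg B hJij) hne, Complex.ofReal_zero, zero_mul]
  · intro J _
    funext l
    simp

end Complexification

/-! ### Real and imaginary parts of the complexified tableau -/

section ComplexTableau

variable {V W : Type*} [AddCommGroup V] [Module ℝ V] [AddCommGroup W] [Module ℝ W]

/-- The real part of a homomorphism of complexifications. -/
def reHom (K : (ℂ ⊗[ℝ] V) →ₗ[ℂ] (ℂ ⊗[ℝ] W)) : V →ₗ[ℝ] W :=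
  rePart ∘ₗ K.restrictScalars ℝ ∘ₗ TensorProduct.mk ℝ ℂ V 1

/-- The imaginary part of a homomorphism of complexifications. -/
def imHom (K : (ℂ ⊗[ℝ] V) →ₗ[ℂ] (ℂ ⊗[ℝ] W)) : V →ₗ[ℝ] W :=
  imPart ∘ₗ K.restrictScalars ℝ ∘ₗ TensorProduct.mk ℝ ℂ V 1

theorem reHom_apply (K : (ℂ ⊗[ℝ] V) →ₗ[ℂ] (ℂ ⊗[ℝ] W)) (v : V) :
    reHom K v = rePart (K ((1 : ℂ) ⊗ₜ[ℝ] v)) := rfl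

theorem imHom_apply (K : (ℂ ⊗[ℝ] V) →ₗ[ℂ] (ℂ ⊗[ℝ] W)) (v : V) :
    imHom K v = imPart (K ((1 : ℂ) ⊗ₜ[ℝ] v)) := rfl

/-- The complexification is `A + iA`: maps with both parts in `A` are closed under complex scalars,
and each such map is the sum of its two parts. -/
theorem mem_complexTableau_iff (A : Submodule ℝ (V →ₗ[ℝ] W))
    (K : (ℂ ⊗[ℝ] V) →ₗ[ℂ] (ℂ ⊗[ℝ] W)) :
    K ∈ complexTableau A ↔ reHom K ∈ A ∧ imHom K ∈ A := by
  constructor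
  · intro h
    induction h using Submodule.span_induction with
    | mem K h =>
      obtain ⟨π, hπ, rfl⟩ := h
      have h1 : reHom (π.baseChange ℂ) = π := by ext; simp [reHom_apply]
      have h2 : imHom (π.baseChange ℂ) = 0 := by ext; simp [imHom_apply]
      rw [h1, h2]
      exact ⟨hπ, A.zero_mem⟩
    | zero =>
      have h1 : reHom (0 : (ℂ ⊗[ℝ] V) →ₗ[ℂ] (ℂ ⊗[ℝ] W)) = 0 := by ext; simp [reHom_apply]
      have h2 : imHom (0 : (ℂ ⊗[ℝ] V) →ₗ[ℂ] (ℂ ⊗[ℝ] W)) = 0 := by ext; simp [imHom_apply]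
      rw [h1, h2]
      exact ⟨A.zero_mem, A.zero_mem⟩
    | add K L _ _ hK hL =>
      have h1 : reHom (K + L) = reHom K + reHom L := by ext; simp [reHom_apply]
      have h2 : imHom (K + L) = imHom K + imHom L := by ext; simp [imHom_apply]
      rw [h1, h2]
      exact ⟨A.add_mem hK.1 hL.1, A.add_mem hK.2 hL.2⟩
    | smul c K _ hK =>
      have h1 : reHom (c • K) = c.re • reHom K - c.im • imHom K := by
        ext; simp [reHom_apply, imHom_apply, rePart_smul]
      have h2 : imHom (c • K) = c.re • imHom K + c.im • reHom K := by
        ext; simp [reHom_apply, imHom_apply, imPart_smul]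
      rw [h1, h2]
      exact ⟨A.sub_mem (A.smul_mem _ hK.1) (A.smul_mem _ hK.2),
        A.add_mem (A.smul_mem _ hK.2) (A.smul_mem _ hK.1)⟩
  · rintro ⟨h1, h2⟩
    have hK : K = (reHom K).baseChange ℂ + Complex.I • (imHom K).baseChange ℂ := by
      ext v
      simp only [TensorProduct.AlgebraTensorModule.curry_apply,
        TensorProduct.curry_apply, LinearMap.coe_restrictScalars, LinearMap.add_apply,
        LinearMap.smul_apply, LinearMap.baseChange_tmul, reHom_apply, imHom_apply]
      rw [tmul_rePart_add_imPart]
    rw [hK]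
    exact Submodule.add_mem _ (Submodule.subset_span ⟨_, h1, rfl⟩)
      (Submodule.smul_mem _ _ (Submodule.subset_span ⟨_, h2, rfl⟩))

end ComplexTableau

/-! ### Curves in regular zero sets -/

/-- Every vector tangent to a regular zero set is the velocity of a smooth curve in that set. -/
theorem exists_curve_in_zero_set {E G : Type*} [NormedAddCommGroup E] [NormedSpace ℝ E]
    [CompleteSpace E] [NormedAddCommGroup G] [NormedSpace ℝ G] [FiniteDimensional ℝ G]
    {F : E → G} (hF : ContDiff ℝ ∞ F) {b k : E} {F' : E →L[ℝ] G} (hF' : HasFDerivAt F F' b)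
    (hsurj : Function.Surjective F') (hb : F b = 0) (hk : F' k = 0) :
    ∃ u : ℝ → E, ContDiffAt ℝ ∞ u 0 ∧ u 0 = b ∧ deriv u 0 = k ∧ ∀ᶠ t in 𝓝 (0 : ℝ), F (u t) = 0 := by
  obtain ⟨R₀, hR₀⟩ := F'.toLinearMap.exists_rightInverse_of_surjective
    (LinearMap.range_eq_top.2 hsurj)
  let R : G →L[ℝ] E := LinearMap.toContinuousLinearMap R₀
  have hR : ∀ y, F' (R y) = y := fun y => LinearMap.congr_fun hR₀ y
  have : CompleteSpace G := FiniteDimensional.complete ℝ G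
  let A : ℝ × G →L[ℝ] E :=
    (ContinuousLinearMap.fst ℝ ℝ G).smulRight k + R ∘L ContinuousLinearMap.snd ℝ ℝ G
  let a : ℝ × G → E := fun z => b + A z
  have ha : ContDiff ℝ ∞ a := contDiff_const.add A.contDiff
  -- With `a (t, y) = b + t k + R y`, the map `h` straightens `F`: its derivative at 0 is the
  -- identity since `F' k = 0` and `F' R = id`. The curve is `a` applied to the local inverse of `h`
  -- along `(t, 0)`.
  let h : ℝ × G → ℝ × G := fun z => (z.1, F (a z))
  have hh : ContDiff ℝ ∞ h := contDiff_fst.prodMk (hF.comp ha)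
  have ha0 : a 0 = b := by simp [a]
  have hh0 : h 0 = 0 := by
    change ((0 : ℝ), F (a 0)) = 0
    rw [ha0, hb]; rfl
  have ha' : HasFDerivAt a A 0 := A.hasFDerivAt.const_add b
  have hh' : HasFDerivAt h ((ContinuousLinearEquiv.refl ℝ (ℝ × G) : ℝ × G →L[ℝ] ℝ × G)) 0 := by
    have h1 : HasFDerivAt (fun z => F (a z)) (F' ∘L A) 0 := by
      rw [← ha0] at hF'
      exact hF'.comp 0 ha'
    refine (hasFDerivAt_fst.prodMk h1).congr_fderiv ?_
    ext z <;> simp [A, hk, hR]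
  have hne : (∞ : WithTop ℕ∞) ≠ 0 := by simp
  let g := hh.contDiffAt.localInverse hh' hne
  have hg0 : g 0 = 0 := by
    have := hh.contDiffAt.localInverse_apply_image hh' hne
    rwa [hh0] at this
  have hg : ContDiffAt ℝ ∞ g 0 := by
    have := hh.contDiffAt.to_localInverse hh' hne
    rwa [hh0] at this
  have hstrict := hh.contDiffAt.hasStrictFDerivAt' hh' hne
  have hg' : HasFDerivAt g (ContinuousLinearMap.id ℝ (ℝ × G)) 0 := by
    have := hstrict.to_localInverse.hasFDerivAt
    rw [hh0] at this
    exact this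
  have hright : ∀ᶠ y in 𝓝 (0 : ℝ × G), h (g y) = y := by
    have := hstrict.eventually_right_inverse
    rwa [hh0] at this
  let j : ℝ → ℝ × G := fun t => (t, 0)
  have hj : ContDiff ℝ ∞ j := contDiff_id.prodMk contDiff_const
  have hj0 : j 0 = 0 := rfl
  have hj' : HasDerivAt j (1, 0) 0 := (hasDerivAt_id 0).prodMk (hasDerivAt_const 0 0)
  refine ⟨fun t => a (g (j t)), ?_, ?_, ?_, ?_⟩
  · exact ha.contDiffAt.comp _ (ContDiffAt.comp (0 : ℝ) (by rwa [hj0]) hj.contDiffAt)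
  · change a (g 0) = b
    rw [hg0, ha0]
  · have h1 : HasDerivAt (fun t => g (j t)) (1, 0) 0 := by
      have h2 : HasFDerivAt g (ContinuousLinearMap.id ℝ (ℝ × G)) (j 0) := hg'
      exact h2.comp_hasDerivAt 0 hj'
    have h3 : HasFDerivAt a A (g (j 0)) := by
      rw [hj0, hg0]; exact ha'
    refine (h3.comp_hasDerivAt 0 h1).deriv.trans ?_
    simp [A]
  · have h1 : Filter.Tendsto j (𝓝 0) (𝓝 0) := hj.continuous.tendsto' 0 0 hj0
    filter_upwards [h1.eventually hright] with t ht
    exact congrArg Prod.snd ht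

/-- Linearly independent functionals are the components of a surjective map. -/
theorem surjective_pi_of_linearIndependent {E : Type*} [AddCommGroup E] [Module ℝ E]
    {c : ℕ} {l : Fin c → E →ₗ[ℝ] ℝ} (hl : LinearIndependent ℝ l) :
    Function.Surjective (LinearMap.pi l) := by
  rw [← LinearMap.range_eq_top]
  by_contra hne
  obtain ⟨g, hg, hg0⟩ := Submodule.exists_le_ker_of_lt_top _ (lt_top_iff_ne_top.2 hne)
  apply hg
  -- A functional that annihilates the range has coefficients that form a linear relation among the
  -- `l i`.
  have hsum : ∑ i, g (Pi.single i 1) • l i = 0 := by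
    ext x
    have h1 : g (LinearMap.pi l x) = 0 := hg0 ⟨x, rfl⟩
    rw [← (Pi.basisFun ℝ (Fin c)).sum_repr (LinearMap.pi l x)] at h1
    simpa [mul_comm] using h1
  have h2 := Fintype.linearIndependent_iff.1 hl _ hsum
  ext i
  simpa using h2 i

/-! ### Frames, planes and local sections -/

section Geometry

variable {m n : ℕ} {M : Type*} [TopologicalSpace M] [ChartedSpace (Model m) M]

/-- The frame at `p` given by linearly independent vectors of the model space. -/
def frameAt (p : M) (u : Fin n → Model m) (hu : LinearIndependent ℝ u) : Frame m n M where
  base := p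
  vec := fun i => toTangent p (u i)
  linearIndependent := hu.map' (toTangent p).toLinearMap (LinearEquiv.ker _)

theorem finrank_spanAt (p : M) {u : Fin n → Model m} (hu : LinearIndependent ℝ u) :
    Module.finrank ℝ (spanAt p u) = n :=
  (frameAt p u hu).toGr.finrank_plane

theorem toGr_eq_frameAt_toGr {p : M} {P : GrFiber m n p} {u : Fin n → Model m}
    (hu : LinearIndependent ℝ u) (h : P.1 = spanAt p u) : P.toGr = (frameAt p u hu).toGr := by
  obtain ⟨P, hP⟩ := P
  subst h
  rfl

/-- At the center of the preferred chart, the differential of the inverse chart is the identity of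
`ℝ^m`. -/
theorem frameFunction_extChartAt [IsManifold (𝓡 m) ∞ M] (φ : FormField m M n) (p : M)
    (u : Fin n → Model m) :
    frameFunction φ p (extChartAt (𝓡 m) p p, u) = φ p (fun i => toTangent p (u i)) := by
  have : IsManifold (𝓡 m) 1 M := IsManifold.of_le (n := ∞) (by simp)
  have h1 : ∀ v : Model m, mfderiv 𝓘(ℝ, Model m) (𝓡 m) (extChartAt (𝓡 m) p).symm
      (extChartAt (𝓡 m) p p) v = v := by
    intro v
    rw [← mfderivWithin_univ, ← ModelWithCorners.range_eq_univ (𝓡 m),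
      mfderivWithin_range_extChartAt_symm]
    rfl
  unfold frameFunction FormField.inChart
  have h2 : ∀ (q : M), q = p → ∀ v : Fin n → Model m,
      (φ q : (Fin n → Model m) → ℝ) v = (φ p : (Fin n → Model m) → ℝ) v := by
    rintro q rfl v; rfl
  refine (h2 _ (extChartAt_to_inv p) _).trans ?_
  exact congrArg (φ p : (Fin n → Model m) → ℝ) (funext fun i => h1 (u i))

theorem vanishesOn_of_frame {φ : FormField m M n} {f : Gr m n M}
    {u : Fin n → TangentSpace (𝓡 m) f.base} (hu : Submodule.span ℝ (Set.range u) = f.plane)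
    (h : φ f.base u = 0) : VanishesOn φ f := by
  have hli : LinearIndependent ℝ u := by
    rw [linearIndependent_iff_card_eq_finrank_span, Set.finrank, hu, f.finrank_plane,
      Fintype.card_fin]
  intro v hv
  let b := Module.Basis.span hli
  have hG : (φ f.base).toAlternatingMap.compLinearMap
      (Submodule.span ℝ (Set.range u)).subtype = 0 := by
    refine alternating_eq_zero_of_basis b ?_
    rw [AlternatingMap.compLinearMap_apply]
    have : (fun i => (Submodule.span ℝ (Set.range u)).subtype (b i)) = u := by
      funext i
      exact congrArg Subtype.val (Module.Basis.span_apply hli i)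
    rw [this]
    exact h
  rw [← hu] at hv
  exact DFunLike.congr_fun hG fun i => ⟨v i, hv i⟩

variable [IsManifold (𝓡 m) ∞ M]

theorem continuous_frameAt_toGr (p : M) :
    Continuous fun u : {u : Fin n → Model m // LinearIndependent ℝ u} =>
      (frameAt p u.1 u.2).toGr := by
  have h1 : Continuous (Frame.toGr : Frame m n M → Gr m n M) := continuous_coinduced_rng
  refine h1.comp (continuous_induced_rng.2 ?_)
  refine continuous_const.prodMk (continuous_pi fun i => ?_)
  have h2 : Continuous fun v : TangentSpace (𝓡 m) p => (⟨p, v⟩ : TangentBundle (𝓡 m) M) :=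
    FiberBundle.continuous_totalSpaceMk (Model m) (TangentSpace (𝓡 m) : M → Type _) p
  exact h2.comp ((continuous_apply i).comp continuous_subtype_val)

theorem continuousOn_toGr {p : M} {γ : ℝ → GrFiber m n p} {u : ℝ → Fin n → Model m} {s : Set ℝ}
    (hu : ContinuousOn u s) (hli : ∀ t ∈ s, LinearIndependent ℝ (u t))
    (hγ : ∀ t ∈ s, (γ t).1 = spanAt p (u t)) : ContinuousOn (fun t => (γ t).toGr) s := by
  rw [continuousOn_iff_continuous_domRestrict] at hu ⊢
  have h1 : Continuous fun t : s =>
      (⟨u t, hli t t.2⟩ : {u : Fin n → Model m // LinearIndependent ℝ u}) := hu.subtype_mk _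
  refine ((continuous_frameAt_toGr p).comp h1).congr fun t => ?_
  exact (toGr_eq_frameAt_toGr (hli t t.2) (hγ t t.2)).symm

/-- Continuity of the span map turns neighborhoods of `e` in the Grassmann bundle into neighborhoods
of a frame in `ℝ^m`, where the calculus takes place. -/
theorem eventually_toGr_mem {e : Gr m n M} {U : Set (Gr m n M)} (hU : IsOpen U) (he : e ∈ U)
    {b : Fin n → Model m} (hb : spanAt e.base b = e.plane) (hli : LinearIndependent ℝ b) :
    ∀ᶠ u in 𝓝 b, LinearIndependent ℝ u ∧
      ∀ f : GrFiber m n e.base, f.1 = spanAt e.base u → f.toGr ∈ U := by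
  have h1 : IsOpen {u : Fin n → Model m | LinearIndependent ℝ u} := isOpen_setOfPred_linearIndependent
  have h2 := (continuous_frameAt_toGr (n := n) e.base).isOpen_preimage U hU
  have h3 := h1.isOpenMap_subtype_val _ h2
  have h4 : b ∈ Subtype.val '' ((fun u : {u : Fin n → Model m // LinearIndependent ℝ u} =>
      (frameAt e.base u.1 u.2).toGr) ⁻¹' U) := by
    refine ⟨⟨b, hli⟩, ?_, rfl⟩
    have h5 : GrFiber.toGr ⟨e.plane, e.finrank_plane⟩ = (frameAt e.base b hli).toGr :=
      toGr_eq_frameAt_toGr hli hb.symm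
    change (frameAt e.base b hli).toGr ∈ U
    rw [← h5]
    exact he
  filter_upwards [h3.mem_nhds h4]
  rintro u ⟨u', hu', rfl⟩
  refine ⟨u'.2, fun f hf => ?_⟩
  rw [toGr_eq_frameAt_toGr u'.2 hf]
  exact hu'

/-- A smooth section of `M1` through `e`, as a moving frame in the preferred chart that extends a
given frame of `e`. -/
theorem exists_moving_frame {M1 : Set (Gr m n M)} (hsec : HasSmoothLocalSections M1)
    {e : Gr m n M} (he : e ∈ M1) {b : Fin n → Model m} (hb : spanAt e.base b = e.plane) :
    ∃ s : Model m → Fin n → Model m,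
      DifferentiableAt ℝ s (extChartAt (𝓡 m) e.base e.base) ∧
      s (extChartAt (𝓡 m) e.base e.base) = b ∧
      ∀ᶠ x in 𝓝 (extChartAt (𝓡 m) e.base e.base), ∀ φ : FormField m M n,
        (∀ f ∈ M1, VanishesOn φ f) → frameFunction φ e.base (x, s x) = 0 := by
  have : IsManifold (𝓡 m) 1 M := IsManifold.of_le (n := ∞) (by simp)
  obtain ⟨σ, hσ, hspan, hnear⟩ := hsec e he
  set p := e.base with hp
  set x₀ := extChartAt (𝓡 m) p p with hx₀
  let τ := trivializationAt (Model m) (TangentSpace (𝓡 m) : M → Type _) p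
  let r : Fin n → M → Model m := fun i q => (τ ⟨q, σ i q⟩).2
  have hr : ∀ q ∈ (chartAt (Model m) p).source, ∀ i,
      r i q = mfderiv (𝓡 m) 𝓘(ℝ, Model m) (extChartAt (𝓡 m) p) q (σ i q) := by
    intro q hq i
    refine Eq.trans ?_ (DFunLike.congr_fun
      (TangentBundle.continuousLinearMapAt_trivializationAt hq) (σ i q))
    have hq' : q ∈ τ.baseSet := by simpa [τ] using hq
    exact (congrFun (τ.coe_linearMapAt_of_mem (R := ℝ) hq') (σ i q)).symm
  have hrp : ∀ i, toTangent p (r i p) = σ i p := by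
    intro i
    rw [hr p (mem_chart_source _ p), mfderiv_extChartAt_self]
    rfl
  have hrdiff : ∀ i, DifferentiableAt ℝ (fun x => r i ((extChartAt (𝓡 m) p).symm x)) x₀ := by
    intro i
    have h1 := (Bundle.contMDiffAt_section p).1 (hσ i)
    have h2 := (contMDiffAt_iff.1 h1).2
    rw [ModelWithCorners.range_eq_univ, contDiffWithinAt_univ] at h2
    exact h2.differentiableAt (by simp)
  -- The section comes with its own frame of `e`. Constant coefficients convert it to `b` at the
  -- base point, and the combinations still lie in the planes of the section nearby.
  have hcoef : ∀ j, ∃ c : Fin n → ℝ, ∑ i, c i • σ i p = toTangent p (b j) := by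
    intro j
    have : toTangent p (b j) ∈ Submodule.span ℝ (Set.range fun i => σ i p) := by
      rw [hspan, ← hb]
      exact Submodule.subset_span ⟨j, rfl⟩
    exact (Submodule.mem_span_range_iff_exists_fun ℝ).1 this
  choose c hc using hcoef
  refine ⟨fun x j => ∑ i, c j i • r i ((extChartAt (𝓡 m) p).symm x), ?_, ?_, ?_⟩
  · refine differentiableAt_pi.2 fun j => ?_
    exact DifferentiableAt.fun_sum fun i _ => (hrdiff i).const_smul (c j i)
  · funext j
    apply (toTangent p).injective
    rw [← hc j, map_sum]
    refine Finset.sum_congr rfl fun i _ => ?_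
    rw [map_smul, extChartAt_to_inv p, hrp]
  · have h1 : Filter.Tendsto (extChartAt (𝓡 m) p).symm (𝓝 x₀) (𝓝 p) := by
      have := continuousAt_extChartAt_symm (I := 𝓡 m) p
      rwa [ContinuousAt, extChartAt_to_inv] at this
    filter_upwards [h1.eventually hnear, extChartAt_target_mem_nhds (I := 𝓡 m) p] with x hx hxt φ hφ
    obtain ⟨f, hf, hfM⟩ := hx
    have hxs : (extChartAt (𝓡 m) p).symm x ∈ (chartAt (Model m) p).source := by
      rw [← extChartAt_source (𝓡 m)]
      exact (extChartAt (𝓡 m) p).map_target hxt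
    refine hφ _ hfM _ fun j => ?_
    let P : Model m →L[ℝ] TangentSpace (𝓡 m) ((extChartAt (𝓡 m) p).symm x) :=
      mfderiv 𝓘(ℝ, Model m) (𝓡 m) (extChartAt (𝓡 m) p).symm x
    have hP : ∀ i, P (r i ((extChartAt (𝓡 m) p).symm x)) = σ i ((extChartAt (𝓡 m) p).symm x) := by
      intro i
      have h3 := mfderivWithin_extChartAt_symm_comp_mfderiv_extChartAt (I := 𝓡 m) hxt
      rw [ModelWithCorners.range_eq_univ, mfderivWithin_univ] at h3
      exact (congrArg P (hr _ hxs i)).trans (DFunLike.congr_fun h3 _)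
    change P (∑ i, c j i • r i ((extChartAt (𝓡 m) p).symm x)) ∈ f.1
    rw [hf, map_sum]
    simp_rw [map_smul, hP]
    exact Submodule.sum_mem _ fun i _ => Submodule.smul_mem _ _ (Submodule.subset_span ⟨i, rfl⟩)

end Geometry

/-! ### Independence of the equations along the fiber -/

section Fiber

variable {m n : ℕ} {M : Type*} [TopologicalSpace M] [ChartedSpace (Model m) M]

/-- The value of a form at `p`, as a form on the model space. -/
def fiberForm (φ : FormField m M n) (p : M) : Model m [⋀^Fin n]→L[ℝ] ℝ := φ p

theorem fiberForm_apply (φ : FormField m M n) (p : M) (u : Fin n → Model m) :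
    fiberForm φ p u = φ p fun i => toTangent p (u i) := rfl

theorem continuous_linearDeriv (ψ : Model m [⋀^Fin n]→L[ℝ] ℝ) :
    Continuous fun u => ψ.1.linearDeriv u := by
  have h : (fun u => ψ.1.linearDeriv u) = fderiv ℝ ψ.1 := by
    funext u
    exact (ψ.1.hasFDerivAt u).fderiv.symm
  rw [h]
  exact (ψ.1.contDiff (n := ∞)).continuous_fderiv (by simp)

theorem differentiableAt_frameFunction {φ : FormField m M n} (hφ : φ.IsSmooth) (p : M)
    (u : Fin n → Model m) :
    DifferentiableAt ℝ (frameFunction φ p) (extChartAt (𝓡 m) p p, u) := by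
  have h1 : DifferentiableAt ℝ (φ.inChart p) (extChartAt (𝓡 m) p p) :=
    ((hφ p).contDiffAt (extChartAt_target_mem_nhds p)).differentiableAt (by simp)
  have h2 : DifferentiableAt ℝ (fun z : Model m × (Fin n → Model m) => φ.inChart p z.1)
      (extChartAt (𝓡 m) p p, u) :=
    DifferentiableAt.comp (f := Prod.fst) (x := (extChartAt (𝓡 m) p p, u)) h1 differentiableAt_fst
  let l : Fin n → Model m × (Fin n → Model m) →L[ℝ] Model m := fun i =>
    ContinuousLinearMap.proj i ∘L ContinuousLinearMap.snd ℝ (Model m) (Fin n → Model m)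
  have h3 : ∀ i : Fin n, HasFDerivAt (fun z : Model m × (Fin n → Model m) => z.2 i) (l i)
      (extChartAt (𝓡 m) p p, u) := fun i => (l i).hasFDerivAt
  exact (h2.hasFDerivAt.continuousAlternatingMap_apply h3).differentiableAt

variable [IsManifold (𝓡 m) ∞ M]

theorem fderiv_frameFunction_comp_inr {φ : FormField m M n} (hφ : φ.IsSmooth) (p : M)
    (u : Fin n → Model m) :
    fderiv ℝ (frameFunction φ p) (extChartAt (𝓡 m) p p, u) ∘L
      ContinuousLinearMap.inr ℝ (Model m) (Fin n → Model m) = (fiberForm φ p).1.linearDeriv u := by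
  have h1 : HasFDerivAt (fun v : Fin n → Model m => (extChartAt (𝓡 m) p p, v))
      (ContinuousLinearMap.inr ℝ (Model m) (Fin n → Model m)) u := hasFDerivAt_prodMk_right _ u
  have h2 := (differentiableAt_frameFunction hφ p u).hasFDerivAt.comp u h1
  have h3 : frameFunction φ p ∘ (fun v : Fin n → Model m => (extChartAt (𝓡 m) p p, v)) =
      fiberForm φ p := by
    funext v
    exact frameFunction_extChartAt φ p v
  rw [h3] at h2
  exact h2.unique ((fiberForm φ p).hasFDerivAt u)

/-- Forms that vanish on a set of planes with local sections through `e` have independent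
differentials at `e` along the fiber as soon as these are independent on the total space. -/
theorem linearIndependent_linearDeriv {M1 : Set (Gr m n M)} (hsec : HasSmoothLocalSections M1)
    {e : Gr m n M} (he : e ∈ M1) {b : Fin n → Model m} (hb : spanAt e.base b = e.plane)
    {c : ℕ} {φ : Fin c → FormField m M n} (hs : ∀ i, (φ i).IsSmooth)
    (hφ : ∀ i, ∀ f ∈ M1, VanishesOn (φ i) f)
    (hli : LinearIndependent ℝ fun i => fderiv ℝ (frameFunction (φ i) e.base)
      (extChartAt (𝓡 m) e.base e.base, b)) :
    LinearIndependent ℝ fun i => (fiberForm (φ i) e.base).1.linearDeriv b := by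
  obtain ⟨s, hsd, hsb, hsv⟩ := exists_moving_frame hsec he hb
  set x₀ := extChartAt (𝓡 m) e.base e.base
  rw [Fintype.linearIndependent_iff] at hli ⊢
  intro g hg
  apply hli
  -- The equations vanish along the section `x ↦ (x, s x)`, so their differentials kill its tangent
  -- vectors. These and the vertical vectors span the total space, hence a relation that holds on
  -- vertical vectors holds everywhere.
  have hd : ∀ i a, fderiv ℝ (frameFunction (φ i) e.base) (x₀, b) (a, fderiv ℝ s x₀ a) = 0 := by
    intro i a
    have h1 : HasFDerivAt (fun x => (x, s x))
        ((ContinuousLinearMap.id ℝ (Model m)).prod (fderiv ℝ s x₀)) x₀ :=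
      (hasFDerivAt_id x₀).prodMk hsd.hasFDerivAt
    have h2 : DifferentiableAt ℝ (frameFunction (φ i) e.base) (x₀, s x₀) :=
      differentiableAt_frameFunction (hs i) _ _
    have h3 := h2.hasFDerivAt.comp x₀ h1
    have h4 : (frameFunction (φ i) e.base ∘ fun x => (x, s x)) =ᶠ[𝓝 x₀] fun _ => (0 : ℝ) := by
      filter_upwards [hsv] with x hx
      exact hx _ (hφ i)
    have h5 := h3.unique ((hasFDerivAt_const (0 : ℝ) x₀).congr_of_eventuallyEq h4)
    rw [hsb] at h5
    exact DFunLike.congr_fun h5 a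
  have hv : ∀ v, ∑ i, g i * fderiv ℝ (frameFunction (φ i) e.base) (x₀, b) (0, v) = 0 := by
    intro v
    have h1 := DFunLike.congr_fun hg v
    have h2 : ∀ i, (fiberForm (φ i) e.base).1.linearDeriv b =
        fderiv ℝ (frameFunction (φ i) e.base) (x₀, b) ∘L
          ContinuousLinearMap.inr ℝ (Model m) (Fin n → Model m) :=
      fun i => (fderiv_frameFunction_comp_inr (hs i) _ _).symm
    simp only [h2] at h1
    simpa using h1
  ext z
  · have h1 : ∀ i, fderiv ℝ (frameFunction (φ i) e.base) (x₀, b) (z, 0) =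
        -fderiv ℝ (frameFunction (φ i) e.base) (x₀, b) (0, fderiv ℝ s x₀ z) := by
      intro i
      rw [eq_neg_iff_add_eq_zero, ← map_add]
      simpa using hd i z
    have h2 := hv (fderiv ℝ s x₀ z)
    simp [h1, h2]
  · simpa using hv z

end Fiber

/-! ### Local equations of the fiber and curves in `M1` -/

section Regular

variable {m n : ℕ} {M : Type*} [TopologicalSpace M] [ChartedSpace (Model m) M]
  [IsManifold (𝓡 m) ∞ M]

theorem IsFirstProlongation.subset {I : System m M} {Ω : Option (FormField m M n)}
    {M1 : Set (Gr m n M)} (hM1 : IsFirstProlongation I Ω M1) : M1 ⊆ regularVariety I Ω := by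
  obtain ⟨⟨e₀, _, rfl⟩, _⟩ := hM1
  exact connectedComponentIn_subset _ _

theorem IsFirstProlongation.isIntegralElement {I : System m M} {Ω : Option (FormField m M n)}
    {M1 : Set (Gr m n M)} (hM1 : IsFirstProlongation I Ω M1) {e : Gr m n M} (he : e ∈ M1) :
    IsIntegralElement I e :=
  (hM1.subset he).1.1.1

/-- Equations of the fiber of `M1` near `e`, in the space of frames. -/
theorem IsFirstProlongation.exists_fiber_equations {I : System m M}
    {Ω : Option (FormField m M n)} {M1 : Set (Gr m n M)} (hM1 : IsFirstProlongation I Ω M1)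
    {e : Gr m n M} (he : e ∈ M1) :
    ∃ (c : ℕ) (φ : Fin c → FormField m M n) (b : Fin n → Model m), (∀ i, φ i ∈ I.forms n) ∧
      spanAt e.base b = e.plane ∧ LinearIndependent ℝ b ∧
      (LinearIndependent ℝ fun i => (fiberForm (φ i) e.base).1.linearDeriv b) ∧
      ∀ᶠ u in 𝓝 b, LinearIndependent ℝ u ∧ ∀ f : GrFiber m n e.base, f.1 = spanAt e.base u →
        (∀ i, fiberForm (φ i) e.base u = 0) → f.toGr ∈ regularVariety I Ω := by
  obtain ⟨⟨hvar, c, φ, hφ, ⟨b', hb', hli⟩, U, hU, heU, hUvar⟩, U', hU', heU', hchar⟩ :=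
    hM1.subset he
  have hmf : ∀ v : TangentSpace (𝓡 m) e.base,
      mfderiv (𝓡 m) 𝓘(ℝ, Model m) (extChartAt (𝓡 m) e.base) e.base v = v := by
    have : IsManifold (𝓡 m) 1 M := IsManifold.of_le (n := ∞) (by simp)
    intro v
    rw [mfderiv_extChartAt_self]
    rfl
  let b : Fin n → Model m := b'
  have hb : spanAt e.base b = e.plane := hb'
  have hli' : LinearIndependent ℝ fun i => fderiv ℝ (frameFunction (φ i) e.base)
      (extChartAt (𝓡 m) e.base e.base, b) := by
    have h1 : (fun j => mfderiv (𝓡 m) 𝓘(ℝ, Model m) (extChartAt (𝓡 m) e.base) e.base (b' j)) = b :=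
      funext fun j => hmf (b' j)
    rw [← h1]
    exact hli
  have hbli : LinearIndependent ℝ b := by
    have h1 : LinearIndependent ℝ b' := by
      rw [linearIndependent_iff_card_eq_finrank_span, Set.finrank, hb', e.finrank_plane,
        Fintype.card_fin]
    exact h1.map' (toTangent e.base).symm.toLinearMap (LinearEquiv.ker _)
  have hsm : ∀ i, (φ i).IsSmooth := fun i => I.smooth n _ (hφ i)
  have hD := linearIndependent_linearDeriv hM1.2 he hb hsm
    (fun i f hf => hM1.isIntegralElement hf _ (hφ i)) hli'
  -- Independence is an open condition, so the same forms exhibit nearby solutions as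
  -- Kähler-ordinary.
  have hDopen : ∀ᶠ u in 𝓝 b,
      LinearIndependent ℝ fun i => (fiberForm (φ i) e.base).1.linearDeriv u := by
    have h1 : Continuous fun u i => (fiberForm (φ i) e.base).1.linearDeriv u :=
      continuous_pi fun i => continuous_linearDeriv _
    exact h1.continuousAt.eventually (isOpen_setOfPred_linearIndependent.mem_nhds hD)
  refine ⟨c, φ, b, hφ, hb, hbli, hD, ?_⟩
  filter_upwards [eventually_toGr_mem hU heU hb hbli, eventually_toGr_mem hU' heU' hb hbli, hDopen]
    with u hu hu' huD
  refine ⟨hu.1, fun f hf h0 => ?_⟩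
  have hford : f.toGr ∈ ordinaryVariety I Ω := by
    refine ⟨hUvar _ (hu.2 f hf) fun i => vanishesOn_of_frame (u := fun j => toTangent e.base (u j))
      hf.symm (h0 i), c, φ, hφ, ⟨fun j => toTangent e.base (u j), hf.symm, ?_⟩, U, hU, hu.2 f hf,
      hUvar⟩
    have h1 : (fun j => mfderiv (𝓡 m) 𝓘(ℝ, Model m) (extChartAt (𝓡 m) e.base) e.base
        (toTangent e.base (u j))) = u := funext fun j => hmf _
    have h2 : LinearIndependent ℝ fun i => fderiv ℝ (frameFunction (φ i) e.base)
        (extChartAt (𝓡 m) e.base e.base, u) := by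
      simp only [← fderiv_frameFunction_comp_inr (hsm _)] at huD
      exact LinearIndependent.of_comp ((ContinuousLinearMap.compL ℝ (Fin n → Model m)
        (Model m × (Fin n → Model m)) ℝ).flip (ContinuousLinearMap.inr ℝ _ _)).toLinearMap huD
    rw [← h1] at h2
    exact h2
  -- The neighborhood on which the characters agree with those at `e` serves for `f` as well.
  refine ⟨hford, U', hU', hu'.2 f hf, fun f' hf' k => ?_⟩
  rw [hchar f' hf' k, hchar f.toGr ⟨hu'.2 f hf, hford⟩ k]

/-- A curve of frames that satisfies the equations of the fiber of `M1` at `e` spans a continuous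
curve in `M1`. -/
theorem IsFirstProlongation.exists_curve {I : System m M}
    {Ω : Option (FormField m M n)} {M1 : Set (Gr m n M)} (hM1 : IsFirstProlongation I Ω M1)
    {e : Gr m n M} (he : e ∈ M1) {c : ℕ} {φ : Fin c → FormField m M n} {b : Fin n → Model m}
    (hb : spanAt e.base b = e.plane)
    (hreg : ∀ᶠ u in 𝓝 b, LinearIndependent ℝ u ∧ ∀ f : GrFiber m n e.base,
      f.1 = spanAt e.base u → (∀ i, fiberForm (φ i) e.base u = 0) → f.toGr ∈ regularVariety I Ω)
    {u : ℝ → Fin n → Model m} (hu : ContDiffAt ℝ ∞ u 0) (hu0 : u 0 = b)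
    (hφu : ∀ᶠ t in 𝓝 (0 : ℝ), ∀ i, fiberForm (φ i) e.base (u t) = 0) :
    ∃ ε > (0 : ℝ), ∃ γ : ℝ → GrFiber m n e.base,
      (∀ t ∈ Set.Ioo (-ε) ε, (γ t).1 = spanAt e.base (u t)) ∧
      ContinuousOn (fun t => (γ t).toGr) (Set.Ioo (-ε) ε) ∧
      ∀ t ∈ Set.Ioo (-ε) ε, (γ t).toGr ∈ M1 := by
  classical
  have h1 : ∀ᶠ t in 𝓝 (0 : ℝ), ContinuousAt u t :=
    ((hu.of_le (m := 1) (by simp)).eventually (by simp)).mono fun t ht => ht.continuousAt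
  have h2 := hu.continuousAt.eventually (hu0.symm ▸ hreg)
  obtain ⟨ε, hε, hball⟩ := Metric.eventually_nhds_iff_ball.1 ((h1.and h2).and hφu)
  rw [Real.ball_eq_Ioo, zero_sub, zero_add] at hball
  -- The value `e` where the frame degenerates is arbitrary; on the chosen interval the frame is
  -- independent.
  let γ : ℝ → GrFiber m n e.base := fun t =>
    if h : LinearIndependent ℝ (u t) then ⟨spanAt e.base (u t), finrank_spanAt _ h⟩
    else ⟨e.plane, e.finrank_plane⟩
  have hγ : ∀ t ∈ Set.Ioo (-ε) ε, (γ t).1 = spanAt e.base (u t) := by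
    intro t ht
    simp only [γ, dif_pos (hball t ht).1.2.1]
  have hcont : ContinuousOn (fun t => (γ t).toGr) (Set.Ioo (-ε) ε) :=
    continuousOn_toGr (fun t ht => (hball t ht).1.1.continuousWithinAt)
      (fun t ht => (hball t ht).1.2.1) hγ
  refine ⟨ε, hε, γ, hγ, hcont, ?_⟩
  have h0 : (0 : ℝ) ∈ Set.Ioo (-ε) ε := by simp [hε]
  have hγ0 : (γ 0).toGr = e := by
    have h3 : γ 0 = ⟨e.plane, e.finrank_plane⟩ := Subtype.ext (by rw [hγ 0 h0, hu0, hb])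
    rw [h3]
    rfl
  have hsub : (fun t => (γ t).toGr) '' Set.Ioo (-ε) ε ⊆ regularVariety I Ω := by
    rintro _ ⟨t, ht, rfl⟩
    exact (hball t ht).1.2.2 _ (hγ t ht) (hball t ht).2
  obtain ⟨⟨e₀, _, rfl⟩, _⟩ := hM1
  rw [connectedComponentIn_eq he]
  -- The image of the interval is connected, consists of regular elements and contains `e`, so it
  -- stays in the component of `e`.
  have h4 := (isPreconnected_Ioo.image _ hcont).subset_connectedComponentIn
    (x := e) ⟨0, h0, hγ0⟩ hsub
  exact fun t ht => h4 ⟨t, ht, rfl⟩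

end Regular

/-! ### Polar pairs and the pencil of sheared planes -/

section PolarPairs

variable {X : Type*} [AddCommGroup X] [Module ℝ X] {e : Submodule ℝ X}

theorem mkQ_eq_zero_iff {x : X} : e.mkQ x = 0 ↔ x ∈ e := by
  rw [Submodule.mkQ_apply, Submodule.Quotient.mk_eq_zero]

theorem range_smulRight_of_ne_zero {V W : Type*} [AddCommGroup V] [Module ℝ V] [AddCommGroup W]
    [Module ℝ W] {ξ : Module.Dual ℝ V} (hξ : ξ ≠ 0) (y : W) :
    LinearMap.range (ξ.smulRight y) = Submodule.span ℝ {y} := by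
  ext z
  rw [LinearMap.mem_range, Submodule.mem_span_singleton]
  constructor
  · rintro ⟨v, rfl⟩
    exact ⟨ξ v, rfl⟩
  · rintro ⟨a, rfl⟩
    obtain ⟨v, rfl⟩ := LinearMap.surjective hξ a
    exact ⟨v, rfl⟩

theorem represents_smulRight {ξ : Module.Dual ℝ e} (hξ : ξ ≠ 0) {w : X} (hw : w ∉ e)
    {f : Submodule ℝ X} (hmap : f.map e.mkQ = Submodule.span ℝ {e.mkQ w})
    (hinf : f ⊓ e = (LinearMap.ker ξ).map e.subtype) :
    Represents e f (ξ.smulRight (e.mkQ w)) := by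
  have hw' : e.mkQ w ≠ 0 := fun h => hw (mkQ_eq_zero_iff.1 h)
  refine ⟨?_, ?_, ?_⟩
  · rw [range_smulRight_of_ne_zero hξ, finrank_span_singleton hw']
  · rw [range_smulRight_of_ne_zero hξ, hmap]
  · rw [hinf]
    congr 1
    ext v
    simp only [LinearMap.mem_ker, LinearMap.smulRight_apply, smul_eq_zero, hw', or_false]

theorem represents_hyperplane_sup_span {ξ : Module.Dual ℝ e} (hξ : ξ ≠ 0) {w : X} (hw : w ∉ e) :
    Represents e ((LinearMap.ker ξ).map e.subtype ⊔ Submodule.span ℝ {w})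
      (ξ.smulRight (e.mkQ w)) := by
  refine represents_smulRight hξ hw ?_ ?_
  · have h1 : e.mkQ ∘ₗ e.subtype = 0 := by ext x; simp
    rw [Submodule.map_sup, Submodule.map_span, Set.image_singleton, ← Submodule.map_comp, h1,
      Submodule.map_zero, bot_sup_eq]
  · apply le_antisymm
    · rintro x ⟨hx, hxe⟩
      obtain ⟨y, hy, z, hz, rfl⟩ := Submodule.mem_sup.1 hx
      obtain ⟨a, rfl⟩ := Submodule.mem_span_singleton.1 hz
      have hye : y ∈ e := Submodule.map_subtype_le _ _ hy
      have ha : a • w ∈ e := (Submodule.add_mem_iff_right e hye).1 hxe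
      by_cases ha0 : a = 0
      · simpa [ha0] using hy
      · exact absurd ((Submodule.smul_mem_iff e ha0).1 ha) hw
    · exact le_inf le_sup_left (Submodule.map_subtype_le _ _)

/-- The linear map `x ↦ x + t ξ(x) w` on `e`. -/
def shear (ξ : Module.Dual ℝ e) (w : X) (t : ℝ) : e →ₗ[ℝ] X := e.subtype + t • ξ.smulRight w

theorem shear_apply (ξ : Module.Dual ℝ e) (w : X) (t : ℝ) (x : e) :
    shear ξ w t x = x + t • ξ x • w := rfl

theorem range_shear_zero (ξ : Module.Dual ℝ e) (w : X) : LinearMap.range (shear ξ w 0) = e := by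
  simp [shear]

theorem hyperplane_le_range_shear (ξ : Module.Dual ℝ e) (w : X) (t : ℝ) :
    (LinearMap.ker ξ).map e.subtype ≤ LinearMap.range (shear ξ w t) := by
  rintro _ ⟨x, hx, rfl⟩
  have hx : ξ x = 0 := hx
  exact ⟨x, by simp [shear_apply, hx]⟩

theorem represents_range_shear {ξ : Module.Dual ℝ e} (hξ : ξ ≠ 0) {w : X} (hw : w ∉ e) {t : ℝ}
    (ht : t ≠ 0) : Represents e (LinearMap.range (shear ξ w t)) (ξ.smulRight (e.mkQ w)) := by
  refine represents_smulRight hξ hw ?_ ?_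
  · rw [← LinearMap.range_comp]
    have : e.mkQ ∘ₗ shear ξ w t = (t • ξ).smulRight (e.mkQ w) := by
      ext x
      rw [LinearMap.comp_apply, shear_apply, map_add, mkQ_eq_zero_iff.2 x.2, zero_add, map_smul,
        map_smul, LinearMap.smulRight_apply, LinearMap.smul_apply, smul_assoc]
    rw [this, range_smulRight_of_ne_zero (smul_ne_zero ht hξ)]
  · apply le_antisymm
    · rintro _ ⟨⟨x, rfl⟩, hx⟩
      have h1 : t • ξ x • w ∈ e := (Submodule.add_mem_iff_right e x.2).1 hx
      have h2 : ξ x = 0 := by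
        by_contra h3
        exact hw ((Submodule.smul_mem_iff e h3).1 ((Submodule.smul_mem_iff e ht).1 h1))
      exact ⟨x, h2, by simp [shear_apply, h2]⟩
    · exact le_inf (hyperplane_le_range_shear ξ w t) (Submodule.map_subtype_le _ _)

/-- Take `v` with `ξ v = 1`. If its image under the shear at `t` is the image of `y` under the shear
at `s`, then comparing modulo `e`, where `w` is nonzero, gives `s ξ(y) = t`; hence `y = v` and `s =
t`. -/
theorem range_shear_injective {ξ : Module.Dual ℝ e} (hξ : ξ ≠ 0) {w : X} (hw : w ∉ e) :
    Function.Injective fun t => LinearMap.range (shear ξ w t) := by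
  intro t s hts
  obtain ⟨v, hv⟩ := LinearMap.surjective hξ 1
  have h1 : shear ξ w t v ∈ LinearMap.range (shear ξ w s) := by
    have : LinearMap.range (shear ξ w t) = LinearMap.range (shear ξ w s) := hts
    rw [← this]
    exact ⟨v, rfl⟩
  obtain ⟨y, hy⟩ := h1
  rw [shear_apply, shear_apply, hv, one_smul] at hy
  have h2 : (s * ξ y - t) • w = v - y := by
    rw [sub_smul, mul_smul, sub_eq_sub_iff_add_eq_add, ← hy, add_comm]
  have h3 : s * ξ y - t = 0 := by
    by_contra h4
    exact hw ((Submodule.smul_mem_iff e h4).1 (h2 ▸ e.sub_mem v.2 y.2))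
  rw [h3, zero_smul] at h2
  have h5 : v = y := Subtype.ext (sub_eq_zero.1 h2.symm)
  rw [← h5, hv] at h3
  linarith

end PolarPairs

/-! ### The derivative depends only on the class modulo the plane -/

section FormDeriv

variable {k V X : Type*} [Field k] [AddCommGroup V] [Module k V] [AddCommGroup X] [Module k X]
  {n : ℕ}

/-- Since `Ψ` vanishes on the range of `ι`, changing one argument by a vector of that range has no
effect. This is why the linearized equations make sense on `Hom(e, T_p M / e)`. -/
theorem map_update_eq_of_sub_mem_range {Ψ : X [⋀^Fin (n + 1)]→ₗ[k] k} {ι : V →ₗ[k] X}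
    (hι : Ψ.compLinearMap ι = 0) (u : Fin (n + 1) → V) (i : Fin (n + 1)) {y z : X}
    (h : y - z ∈ LinearMap.range ι) :
    Ψ (Function.update (fun j => ι (u j)) i y) = Ψ (Function.update (fun j => ι (u j)) i z) := by
  obtain ⟨v, hv⟩ := h
  rw [← sub_eq_zero, ← AlternatingMap.map_update_sub, ← hv]
  have h1 : Function.update (fun j => ι (u j)) i (ι v) = fun j => ι (Function.update u i v j) := by
    funext j
    rw [← Function.apply_update (fun _ => ι)]
  rw [h1]
  exact DFunLike.congr_fun hι (Function.update u i v)

theorem formDeriv_congr {Ψ : X [⋀^Fin (n + 1)]→ₗ[k] k} {ι : V →ₗ[k] X}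
    (hι : Ψ.compLinearMap ι = 0) {L L' : V →ₗ[k] X}
    (h : ∀ v, L v - L' v ∈ LinearMap.range ι) : formDeriv Ψ ι L = formDeriv Ψ ι L' := by
  ext u
  rw [formDeriv_apply, formDeriv_apply]
  exact Finset.sum_congr rfl fun i _ => map_update_eq_of_sub_mem_range hι u i (h (u i))

theorem formDeriv_add (Ψ : X [⋀^Fin (n + 1)]→ₗ[k] k) (ι L L' : V →ₗ[k] X) :
    formDeriv Ψ ι (L + L') = formDeriv Ψ ι L + formDeriv Ψ ι L' := by
  ext u
  simp [formDeriv_apply, Finset.sum_add_distrib]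

theorem formDeriv_smul (Ψ : X [⋀^Fin (n + 1)]→ₗ[k] k) (ι L : V →ₗ[k] X) (c : k) :
    formDeriv Ψ ι (c • L) = c • formDeriv Ψ ι L := by
  ext u
  simp [formDeriv_apply, Finset.mul_sum]

theorem formDeriv_zero (Ψ : X [⋀^Fin (n + 1)]→ₗ[k] k) (ι : V →ₗ[k] X) :
    formDeriv Ψ ι 0 = 0 := by
  simpa using formDeriv_smul Ψ ι 0 0

end FormDeriv

/-! ### The tableau as the solutions of the linearized equations -/

section Tableau

variable {m n : ℕ} {M : Type*} [TopologicalSpace M] [ChartedSpace (Model m) M]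

instance (p : M) : FiniteDimensional ℝ (TangentSpace (𝓡 m) p) :=
  inferInstanceAs (FiniteDimensional ℝ (Model m))

theorem IsIntegralElement.compLinearMap_subtype {I : System m M} {e : Gr m n M}
    (he : IsIntegralElement I e) {φ : FormField m M n} (hφ : φ ∈ I.forms n) :
    (φ e.base).toAlternatingMap.compLinearMap e.plane.subtype = 0 := by
  ext u
  exact he φ hφ (fun i => u i) fun i => (u i).2

theorem exists_plane_basis {e : Gr m n M} {b : Fin n → Model m}
    (hb : spanAt e.base b = e.plane) :
    ∃ B : Module.Basis (Fin n) ℝ e.plane, ∀ i, (B i : TangentSpace (𝓡 m) e.base) =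
      toTangent e.base (b i) := by
  have hmem : ∀ i, toTangent e.base (b i) ∈ e.plane := fun i =>
    hb ▸ Submodule.subset_span ⟨i, rfl⟩
  have hspan : ⊤ ≤ Submodule.span ℝ
      (Set.range fun i => (⟨toTangent e.base (b i), hmem i⟩ : e.plane)) := by
    rintro ⟨x, hx⟩ -
    rw [← hb] at hx
    obtain ⟨c, hc⟩ := (Submodule.mem_span_range_iff_exists_fun ℝ).1 hx
    refine (Submodule.mem_span_range_iff_exists_fun ℝ).2 ⟨c, Subtype.ext ?_⟩
    simpa using hc
  have hli := linearIndependent_of_top_le_span_of_card_eq_finrank hspan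
    (by rw [Fintype.card_fin, e.finrank_plane])
  exact ⟨Module.Basis.mk hli hspan, fun i => by rw [Module.Basis.mk_apply]⟩

variable [IsManifold (𝓡 m) ∞ M]

/-- The tableau at `e ∈ M1` is the space of solutions of the linearized equations. -/
theorem IsFirstProlongation.mem_tableau_iff {I : System m M}
    {Ω : Option (FormField m M (n + 1))} {M1 : Set (Gr m (n + 1) M)}
    (hM1 : IsFirstProlongation I Ω M1) {e : Gr m (n + 1) M} (he : e ∈ M1)
    {s : (TangentSpace (𝓡 m) e.base ⧸ e.plane) →ₗ[ℝ] TangentSpace (𝓡 m) e.base}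
    (hs : e.plane.mkQ ∘ₗ s = LinearMap.id)
    (K : e.plane →ₗ[ℝ] (TangentSpace (𝓡 m) e.base ⧸ e.plane)) :
    K ∈ tableau M1 e ↔ ∀ φ ∈ I.forms (n + 1),
      formDeriv (φ e.base).toAlternatingMap e.plane.subtype (s ∘ₗ K) = 0 := by
  have hs' : ∀ y, e.plane.mkQ (s y) = y := fun y => LinearMap.congr_fun hs y
  constructor
  · intro hK φ hφ
    have hint := (hM1.isIntegralElement he).compLinearMap_subtype hφ
    induction hK using Submodule.span_induction with
    | mem K hK =>
      obtain ⟨γ, ⟨hγ0, u, hu, hγu, hKu⟩, hγM⟩ := hK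
      have hu0 : spanAt e.base (u 0) = e.plane := by rw [← hγu.self_of_nhds, hγ0]
      obtain ⟨B, hB⟩ := exists_plane_basis hu0
      refine alternating_eq_zero_of_basis B ?_
      have hzero : ∀ᶠ t in 𝓝 (0 : ℝ), fiberForm φ e.base (u t) = 0 := by
        filter_upwards [hγu, hγM] with t ht htM
        refine hM1.isIntegralElement htM φ hφ (fun i => toTangent e.base (u t i)) fun i => ?_
        change _ ∈ (γ t).1
        rw [ht]
        exact Submodule.subset_span ⟨i, rfl⟩
      have hder : HasDerivAt u (deriv u 0) 0 := (hu.differentiableAt (by simp)).hasDerivAt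
      have h1 := ((fiberForm φ e.base).hasFDerivAt (u 0)).comp_hasDerivAt 0 hder
      have h2 := h1.unique ((hasDerivAt_const (0 : ℝ) (0 : ℝ)).congr_of_eventuallyEq hzero)
      rw [ContinuousMultilinearMap.linearDeriv_apply] at h2
      rw [formDeriv_apply, ← h2]
      refine Finset.sum_congr rfl fun i _ => ?_
      -- The frame velocity and the lift of `K` by `s` agree only modulo `e`, which suffices because
      -- `φ` vanishes on `e`.
      have h3 : (s ∘ₗ K) (B i) - toTangent e.base (deriv u 0 i) ∈
          LinearMap.range e.plane.subtype := by
        rw [Submodule.range_subtype, ← mkQ_eq_zero_iff, map_sub, LinearMap.comp_apply, hs',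
          sub_eq_zero, ← hKu i (by rw [← hB]; exact (B i).2)]
        congr 1
        exact Subtype.ext (hB i)
      rw [map_update_eq_of_sub_mem_range hint B i h3]
      have h4 : (fun j => e.plane.subtype (B j)) = fun j => toTangent e.base (u 0 j) :=
        funext hB
      rw [h4]
      rfl
    | zero => rw [LinearMap.comp_zero, formDeriv_zero]
    | add K L _ _ hK hL => rw [LinearMap.comp_add, formDeriv_add, hK, hL, add_zero]
    | smul c K _ hK => rw [LinearMap.comp_smul, formDeriv_smul, hK, smul_zero]
  · intro hK
    obtain ⟨c, φ, b, hφ, hb, hbli, hli, hreg⟩ := hM1.exists_fiber_equations he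
    obtain ⟨B, hB⟩ := exists_plane_basis hb
    let F : (Fin (n + 1) → Model m) → Fin c → ℝ := fun u i => fiberForm (φ i) e.base u
    let F' : (Fin (n + 1) → Model m) →L[ℝ] Fin c → ℝ :=
      ContinuousLinearMap.pi fun i => (fiberForm (φ i) e.base).1.linearDeriv b
    have hF : ContDiff ℝ ∞ F := contDiff_pi.2 fun i => (fiberForm (φ i) e.base).1.contDiff
    have hF' : HasFDerivAt F F' b := hasFDerivAt_pi.2 fun i => (fiberForm (φ i) e.base).hasFDerivAt b
    have hsurj : Function.Surjective F' := by
      have h1 : LinearIndependent ℝ fun i =>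
          ((fiberForm (φ i) e.base).1.linearDeriv b).toLinearMap :=
        hli.map' (ContinuousLinearMap.coeLM ℝ)
          (LinearMap.ker_eq_bot.2 ContinuousLinearMap.coe_injective)
      exact surjective_pi_of_linearIndependent h1
    have hb0 : F b = 0 := by
      funext i
      refine hM1.isIntegralElement he _ (hφ i) (fun j => toTangent e.base (b j)) fun j => ?_
      rw [← hB]
      exact (B j).2
    -- Lifting `K` by `s` gives a frame velocity, which the linearized equations place in the kernel
    -- of `F'`. Thus every solution is itself a velocity, not merely a combination of velocities.
    let k : Fin (n + 1) → Model m := fun j => (toTangent e.base).symm (s (K (B j)))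
    have hk : F' k = 0 := by
      funext i
      have h1 := DFunLike.congr_fun (hK _ (hφ i)) (B : Fin (n + 1) → e.plane)
      rw [formDeriv_apply] at h1
      have h4 : (fun j => e.plane.subtype (B j)) = fun j => toTangent e.base (b j) :=
        funext hB
      rw [h4] at h1
      refine (ContinuousMultilinearMap.linearDeriv_apply _ _ _).trans ?_
      exact h1
    obtain ⟨u, hu, hu0, huk, huF⟩ := exists_curve_in_zero_set hF hF' hsurj hb0 hk
    obtain ⟨ε, hε, γ, hγ, -, hγM⟩ := hM1.exists_curve he hb hreg hu hu0
      (huF.mono fun t ht i => congrFun ht i)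
    have hnear : Set.Ioo (-ε) ε ∈ 𝓝 (0 : ℝ) := Ioo_mem_nhds (by simpa using hε) hε
    refine Submodule.subset_span ⟨γ, ⟨?_, u, hu, ?_, ?_⟩, ?_⟩
    · rw [hγ 0 ⟨by simpa using hε, hε⟩, hu0, hb]
    · filter_upwards [hnear] with t ht using hγ t ht
    · rw [hu0, huk]
      intro i hi
      have h1 : (⟨toTangent e.base (b i), hi⟩ : e.plane) = B i := Subtype.ext (hB i).symm
      rw [h1, LinearEquiv.apply_symm_apply, hs']
    · filter_upwards [hnear] with t ht using hγM t ht

theorem exists_mkQ_rightInverse {X : Type*} [AddCommGroup X] [Module ℝ X] (e : Submodule ℝ X) :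
    ∃ s : (X ⧸ e) →ₗ[ℝ] X, e.mkQ ∘ₗ s = LinearMap.id :=
  e.mkQ.exists_rightInverse_of_surjective (Submodule.range_mkQ e)

/-- The integral extension makes all linearized equations hold in the direction `w ⊗ ξ`, so this
direction is in the tableau. If the extension differs from `e` then `w ∉ e`, and the required curve
is the pencil of sheared planes. -/
theorem IsFirstProlongation.polar_extension {I : System m M}
    {Ω : Option (FormField m M (n + 1))} {M1 : Set (Gr m (n + 1) M)}
    (hM1 : IsFirstProlongation I Ω M1) {e : Gr m (n + 1) M} (he : e ∈ M1)
    {ξ : Module.Dual ℝ e.plane} {f : GrFiber m (n + 1) e.base} {w : TangentSpace (𝓡 m) e.base}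
    (hξ : ξ ≠ 0) (hint : IsIntegralElement I f.toGr)
    (hf : f.1 = (LinearMap.ker ξ).map e.plane.subtype ⊔ Submodule.span ℝ {w}) :
    ξ.smulRight (e.plane.mkQ w) ∈ tableau M1 e ∧
      (f.1 ≠ e.plane →
        Represents e.plane f.1 (ξ.smulRight (e.plane.mkQ w)) ∧
        ∃ ε > (0 : ℝ), ∃ γ : ℝ → GrFiber m (n + 1) e.base,
          HasVelocity e γ (ξ.smulRight (e.plane.mkQ w)) ∧
          ContinuousOn (fun t => (γ t).toGr) (Set.Ioo (-ε) ε) ∧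
          Set.InjOn γ (Set.Ioo (-ε) ε) ∧
          ∀ t ∈ Set.Ioo (-ε) ε, (γ t).toGr ∈ M1 ∧
            (LinearMap.ker ξ).map e.plane.subtype ≤ (γ t).1 ∧
            (t ≠ 0 → Represents e.plane (γ t).1 (ξ.smulRight (e.plane.mkQ w)))) := by
  have hzero : ∀ φ ∈ I.forms (n + 1),
      formDeriv (φ e.base).toAlternatingMap e.plane.subtype (ξ.smulRight w) = 0 := by
    intro φ hφ
    rw [← vanishes_on_extension_iff e.finrank_plane _ _ hξ, ← hf]
    exact fun z hz => hint φ hφ z hz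
  have hvan : ∀ φ ∈ I.forms (n + 1), (φ e.base).toAlternatingMap.compLinearMap e.plane.subtype = 0 :=
    fun φ hφ => (hM1.isIntegralElement he).compLinearMap_subtype hφ
  constructor
  · obtain ⟨s, hs⟩ := exists_mkQ_rightInverse e.plane
    rw [hM1.mem_tableau_iff he hs]
    intro φ hφ
    rw [← hzero φ hφ]
    refine formDeriv_congr (hvan φ hφ) fun v => ?_
    rw [Submodule.range_subtype, ← mkQ_eq_zero_iff, map_sub, LinearMap.comp_apply,
      LinearMap.smulRight_apply, LinearMap.smulRight_apply, ← LinearMap.comp_apply e.plane.mkQ s,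
      hs, LinearMap.id_apply, map_smul, sub_self]
  · intro hne
    have hw : w ∉ e.plane := by
      intro hw
      apply hne
      refine Submodule.eq_of_le_of_finrank_eq ?_ (f.2.trans e.finrank_plane.symm)
      rw [hf]
      exact sup_le (Submodule.map_subtype_le _ _)
        ((Submodule.span_singleton_le_iff_mem _ _).2 hw)
    refine ⟨hf ▸ represents_hyperplane_sup_span hξ hw, ?_⟩
    obtain ⟨c, φ, b, hφ, hb, hbli, hli, hreg⟩ := hM1.exists_fiber_equations he
    obtain ⟨B, hB⟩ := exists_plane_basis hb
    -- The velocity of the frame `b` under the shear, which makes `u t` a frame of the sheared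
    -- plane.
    let v : Fin (n + 1) → Model m := fun j => ξ (B j) • (toTangent e.base).symm w
    let u : ℝ → Fin (n + 1) → Model m := fun t => b + t • v
    have hushear : ∀ t j, toTangent e.base (u t j) = shear ξ w t (B j) := by
      intro t j
      simp [u, v, shear_apply, hB]
    have hrange : ∀ t, spanAt e.base (u t) = LinearMap.range (shear ξ w t) := by
      intro t
      rw [LinearMap.range_eq_map, ← B.span_eq, Submodule.map_span, ← Set.range_comp, spanAt]
      congr 2
      funext j
      exact hushear t j
    have hu : ContDiff ℝ ∞ u := contDiff_const.add (contDiff_id.smul contDiff_const)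
    have hu0 : u 0 = b := by simp [u]
    have hu' : deriv u 0 = v := by
      have h1 : HasDerivAt u ((1 : ℝ) • v) 0 := ((hasDerivAt_id (0 : ℝ)).smul_const v).const_add b
      rw [h1.deriv, one_smul]
    have hφu : ∀ t i, fiberForm (φ i) e.base (u t) = 0 := by
      intro t i
      have h1 := compLinearMap_add_smulRight_eq_zero e.finrank_plane (hvan _ (hφ i)) hξ
        (hzero _ (hφ i)) t
      have h2 := DFunLike.congr_fun h1 (B : Fin (n + 1) → e.plane)
      rw [fiberForm_apply]
      simp_rw [hushear]
      exact h2
    obtain ⟨ε, hε, γ, hγ, hγc, hγM⟩ := hM1.exists_curve he hb hreg hu.contDiffAt hu0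
      (Filter.Eventually.of_forall fun t => hφu t)
    have hγ' : ∀ t ∈ Set.Ioo (-ε) ε, (γ t).1 = LinearMap.range (shear ξ w t) :=
      fun t ht => (hγ t ht).trans (hrange t)
    have hnear : Set.Ioo (-ε) ε ∈ 𝓝 (0 : ℝ) := Ioo_mem_nhds (by simpa using hε) hε
    refine ⟨ε, hε, γ, ⟨?_, u, hu.contDiffAt, ?_, ?_⟩, hγc, ?_, fun t ht => ⟨hγM t ht, ?_, ?_⟩⟩
    · rw [hγ' 0 (mem_of_mem_nhds hnear), range_shear_zero]
    · filter_upwards [hnear] with t ht using hγ t ht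
    · rw [hu0, hu']
      intro i hi
      have h1 : (⟨toTangent e.base (b i), hi⟩ : e.plane) = B i := Subtype.ext (hB i).symm
      rw [h1, map_smul, LinearEquiv.apply_symm_apply, map_smul, LinearMap.smulRight_apply]
    · intro t ht t' ht' htt
      have h1 := congrArg Subtype.val htt
      rw [hγ' t ht, hγ' t' ht'] at h1
      exact range_shear_injective hξ hw h1
    · rw [hγ' t ht]
      exact hyperplane_le_range_shear ξ w t
    · intro ht0
      rw [hγ' t ht]
      exact represents_range_shear hξ hw ht0

end Tableau

/-! ### Complexification of the linearized equations -/

section BaseChange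

variable {X : Type*} [AddCommGroup X] [Module ℝ X]

theorem mkQ_baseChange_surjective (e : Submodule ℝ X) :
    Function.Surjective (e.mkQ.baseChange ℂ) :=
  LinearMap.lTensor_surjective ℂ e.mkQ_surjective

theorem ker_mkQ_baseChange (e : Submodule ℝ X) :
    LinearMap.ker (e.mkQ.baseChange ℂ) = LinearMap.range (e.subtype.baseChange ℂ) := by
  have h1 : Function.Exact e.subtype e.mkQ := by
    rw [LinearMap.exact_iff, Submodule.ker_mkQ, Submodule.range_subtype]
  have h2 : Function.Exact (e.subtype.baseChange ℂ) (e.mkQ.baseChange ℂ) :=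
    lTensor_exact ℂ h1 e.mkQ_surjective
  ext z
  exact h2 z

theorem subtype_baseChange_injective (e : Submodule ℝ X) :
    Function.Injective (e.subtype.baseChange ℂ) :=
  Module.Flat.lTensor_preserves_injective_linearMap e.subtype e.subtype_injective

/-- The complex linearized equation in a direction of rank one is equivalent to the real linearized
equations for its real and imaginary parts. -/
theorem formDeriv_complex_eq_zero_iff {n : ℕ} {e : Submodule ℝ X}
    (he : Module.finrank ℝ e = n + 1) {φ : X [⋀^Fin (n + 1)]→ₗ[ℝ] ℝ}
    (hφ : φ.compLinearMap e.subtype = 0) {Φ : (ℂ ⊗[ℝ] X) [⋀^Fin (n + 1)]→ₗ[ℂ] ℂ}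
    (hΦ : ∀ x : Fin (n + 1) → X, Φ (fun j => (1 : ℂ) ⊗ₜ[ℝ] x j) = φ x)
    {s : (X ⧸ e) →ₗ[ℝ] X} (hs : e.mkQ ∘ₗ s = LinearMap.id)
    (ξ : Module.Dual ℂ (ℂ ⊗[ℝ] e)) (v : ℂ ⊗[ℝ] X) :
    formDeriv Φ (e.subtype.baseChange ℂ) (ξ.smulRight v) = 0 ↔
      formDeriv φ e.subtype (s ∘ₗ reHom (ξ.smulRight (e.mkQ.baseChange ℂ v))) = 0 ∧
      formDeriv φ e.subtype (s ∘ₗ imHom (ξ.smulRight (e.mkQ.baseChange ℂ v))) = 0 := by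
  set K := ξ.smulRight (e.mkQ.baseChange ℂ v) with hK
  have hs' : ∀ y, e.mkQ (s y) = y := fun y => LinearMap.congr_fun hs y
  have : FiniteDimensional ℝ e := FiniteDimensional.of_finrank_pos (by omega)
  let B := Module.finBasisOfFinrankEq ℝ e he
  let BC : Module.Basis (Fin (n + 1)) ℂ (ℂ ⊗[ℝ] e) := B.baseChange ℂ
  have hBC : ∀ j, BC j = (1 : ℂ) ⊗ₜ[ℝ] B j := fun j => Module.Basis.baseChange_apply _ _ _
  have hΦe : Φ.compLinearMap (e.subtype.baseChange ℂ) = 0 := by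
    refine alternating_eq_zero_of_basis BC ?_
    rw [AlternatingMap.compLinearMap_apply]
    simp_rw [hBC, LinearMap.baseChange_tmul]
    rw [hΦ]
    exact_mod_cast DFunLike.congr_fun hφ (B : Fin (n + 1) → e)
  have key : ∀ u : Fin (n + 1) → e,
      formDeriv Φ (e.subtype.baseChange ℂ) (ξ.smulRight v) (fun j => (1 : ℂ) ⊗ₜ[ℝ] u j) =
        (formDeriv φ e.subtype (s ∘ₗ reHom K) u : ℂ) +
          Complex.I * (formDeriv φ e.subtype (s ∘ₗ imHom K) u : ℂ) := by
    intro u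
    have hupd : ∀ (i : Fin (n + 1)) (x : X),
        Φ (Function.update (fun j => (e.subtype.baseChange ℂ) ((1 : ℂ) ⊗ₜ[ℝ] u j)) i
          ((1 : ℂ) ⊗ₜ[ℝ] x)) = φ (Function.update (fun j => e.subtype (u j)) i x) := by
      intro i x
      rw [← hΦ]
      congr 1
      funext j
      rw [Function.apply_update (fun _ y => (1 : ℂ) ⊗ₜ[ℝ] y)]
      rfl
    simp only [formDeriv_apply]
    push_cast
    rw [Finset.mul_sum, ← Finset.sum_add_distrib]
    refine Finset.sum_congr rfl fun i _ => ?_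
    -- Modulo the complexification of `e`, the vector `ξ(u i) v` is its real part plus `i` times its
    -- imaginary part, each lifted by `s`.
    have hmem : (ξ.smulRight v) ((1 : ℂ) ⊗ₜ[ℝ] u i) -
        ((1 : ℂ) ⊗ₜ[ℝ] (s ∘ₗ reHom K) (u i) +
          Complex.I • ((1 : ℂ) ⊗ₜ[ℝ] (s ∘ₗ imHom K) (u i))) ∈
        LinearMap.range (e.subtype.baseChange ℂ) := by
      rw [← ker_mkQ_baseChange, LinearMap.mem_ker, map_sub, map_add, map_smul,
        LinearMap.baseChange_tmul, LinearMap.baseChange_tmul, LinearMap.comp_apply,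
        LinearMap.comp_apply, hs', hs', reHom_apply, imHom_apply, tmul_rePart_add_imPart, hK,
        LinearMap.smulRight_apply, LinearMap.smulRight_apply, map_smul, sub_self]
    rw [map_update_eq_of_sub_mem_range hΦe _ i hmem, AlternatingMap.map_update_add,
      AlternatingMap.map_update_smul, hupd, hupd, smul_eq_mul]
    rfl
  constructor
  · intro h
    have h1 : ∀ u, formDeriv φ e.subtype (s ∘ₗ reHom K) u = 0 ∧
        formDeriv φ e.subtype (s ∘ₗ imHom K) u = 0 := by
      intro u
      have h2 := key u
      rw [h, AlternatingMap.zero_apply] at h2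
      have h3 := congrArg Complex.re h2
      have h4 := congrArg Complex.im h2
      simp at h3 h4
      exact ⟨h3.symm, h4.symm⟩
    exact ⟨AlternatingMap.ext fun u => (h1 u).1, AlternatingMap.ext fun u => (h1 u).2⟩
  · rintro ⟨h1, h2⟩
    refine alternating_eq_zero_of_basis BC ?_
    have h3 : (BC : Fin (n + 1) → ℂ ⊗[ℝ] e) = fun j => (1 : ℂ) ⊗ₜ[ℝ] B j := funext hBC
    rw [h3, key, h1, h2]
    simp

end BaseChange

/-! ### Polar spaces, polar rank and the characteristic variety -/

section Characteristic

variable {m n : ℕ} {M : Type*} [TopologicalSpace M] [ChartedSpace (Model m) M]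
  [IsManifold (𝓡 m) ∞ M]

/-- The fiber of the complex rank-one cone over a covector. -/
def coneFiber {V W : Type*} [AddCommGroup V] [Module ℝ V] [AddCommGroup W] [Module ℝ W]
    (A : Submodule ℝ (V →ₗ[ℝ] W)) (ξ : Module.Dual ℂ (ℂ ⊗[ℝ] V)) : Submodule ℂ (ℂ ⊗[ℝ] W) :=
  (complexTableau A).comap (LinearMap.smulRightₗ ξ)

theorem mem_coneFiber {V W : Type*} [AddCommGroup V] [Module ℝ V] [AddCommGroup W] [Module ℝ W]
    {A : Submodule ℝ (V →ₗ[ℝ] W)} {ξ : Module.Dual ℂ (ℂ ⊗[ℝ] V)} {w : ℂ ⊗[ℝ] W} :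
    w ∈ coneFiber A ξ ↔ ξ.smulRight w ∈ complexTableau A := Iff.rfl

/-- For each form of the ideal, both memberships express the same complex linearized equation in the
direction `v ⊗ ξ`. In particular the polar space is a linear subspace. -/
theorem IsFirstProlongation.polarSet_eq {I : System m M}
    {Ω : Option (FormField m M (n + 1))} {M1 : Set (Gr m (n + 1) M)}
    (hM1 : IsFirstProlongation I Ω M1) {e : Gr m (n + 1) M} (he : e ∈ M1)
    {ξ : Module.Dual ℂ (ℂ ⊗[ℝ] e.plane)} (hξ : ξ ≠ 0) :
    polarSet (n + 1) I (hyperplane ξ) =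
      ((coneFiber (tableau M1 e) ξ).comap (e.plane.mkQ.baseChange ℂ) : Set _) := by
  obtain ⟨s, hs⟩ := exists_mkQ_rightInverse e.plane
  have hdim : Module.finrank ℂ (ℂ ⊗[ℝ] e.plane) = n + 1 := by
    rw [Module.finrank_baseChange, e.finrank_plane]
  ext v
  rw [SetLike.mem_coe, Submodule.mem_comap, mem_coneFiber, mem_complexTableau_iff,
    hM1.mem_tableau_iff he hs, hM1.mem_tableau_iff he hs, ← forall₂_and]
  refine forall₂_congr fun φ hφ => ?_
  obtain ⟨Φ, hΦ, hΦ'⟩ := exists_alternatingMap_eq_complexEval (φ e.base).toAlternatingMap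
  rw [← formDeriv_complex_eq_zero_iff e.finrank_plane
    ((hM1.isIntegralElement he).compLinearMap_subtype hφ) hΦ' hs,
    ← vanishes_on_extension_iff hdim _ _ hξ]
  simp_rw [← hΦ]
  rfl

theorem IsFirstProlongation.image_polarSet {I : System m M}
    {Ω : Option (FormField m M (n + 1))} {M1 : Set (Gr m (n + 1) M)}
    (hM1 : IsFirstProlongation I Ω M1) {e : Gr m (n + 1) M} (he : e ∈ M1)
    {ξ : Module.Dual ℂ (ℂ ⊗[ℝ] e.plane)} (hξ : ξ ≠ 0) :
    (e.plane.mkQ.baseChange ℂ) '' polarSet (n + 1) I (hyperplane ξ) =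
      coneFiber (tableau M1 e) ξ := by
  rw [hM1.polarSet_eq he hξ, Submodule.comap_coe,
    Set.image_preimage_eq _ (mkQ_baseChange_surjective _)]

theorem finrank_hyperplane {X : Type*} [AddCommGroup X] [Module ℝ X] {e : Submodule ℝ X}
    (he : Module.finrank ℝ e = n + 1) {ξ : Module.Dual ℂ (ℂ ⊗[ℝ] e)} (hξ : ξ ≠ 0) :
    Module.finrank ℂ (hyperplane ξ) = n := by
  have hdim : Module.finrank ℂ (ℂ ⊗[ℝ] e) = n + 1 := by rw [Module.finrank_baseChange, he]
  have : FiniteDimensional ℂ (ℂ ⊗[ℝ] e) := FiniteDimensional.of_finrank_pos (by omega)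
  rw [hyperplane, ← (Submodule.equivMapOfInjective _ (subtype_baseChange_injective e)
    (LinearMap.ker ξ)).finrank_eq]
  have h := ξ.finrank_range_add_finrank_ker
  rw [LinearMap.range_eq_top.2 (LinearMap.surjective hξ), finrank_top, Module.finrank_self,
    hdim] at h
  omega

theorem finrank_comap_mkQ_baseChange {X : Type*} [AddCommGroup X] [Module ℝ X]
    [FiniteDimensional ℝ X] (e : Submodule ℝ X) (F : Submodule ℂ (ℂ ⊗[ℝ] (X ⧸ e))) :
    Module.finrank ℂ (F.comap (e.mkQ.baseChange ℂ)) =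
      Module.finrank ℂ F + Module.finrank ℝ e := by
  set q := e.mkQ.baseChange ℂ
  have h := (q.domRestrict (F.comap q)).finrank_range_add_finrank_ker
  have h1 : LinearMap.range (q.domRestrict (F.comap q)) = F := by
    rw [LinearMap.range_domRestrict,
      Submodule.map_comap_eq_of_surjective (mkQ_baseChange_surjective e)]
  have h2 : Module.finrank ℂ (LinearMap.ker (q.domRestrict (F.comap q))) = Module.finrank ℝ e := by
    have h3 : LinearMap.ker (q.domRestrict (F.comap q)) =
        (LinearMap.ker q).comap (F.comap q).subtype := rfl
    rw [h3, (Submodule.comapSubtypeEquivOfLe (LinearMap.ker_le_comap q)).finrank_eq,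
      ker_mkQ_baseChange, LinearMap.finrank_range_of_inj (subtype_baseChange_injective e),
      Module.finrank_baseChange]
  rw [← h, h1, h2]

/-- The polar space is a preimage, so it exceeds the cone fiber in dimension by `dim e = n + 1`;
this is exactly the dimension `n` of the hyperplane plus the 1 subtracted in the polar rank. -/
theorem IsFirstProlongation.polarRank_eq {I : System m M}
    {Ω : Option (FormField m M (n + 1))} {M1 : Set (Gr m (n + 1) M)}
    (hM1 : IsFirstProlongation I Ω M1) {e : Gr m (n + 1) M} (he : e ∈ M1)
    {ξ : Module.Dual ℂ (ℂ ⊗[ℝ] e.plane)} (hξ : ξ ≠ 0) :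
    polarRank (n + 1) I (hyperplane ξ) = Module.finrank ℂ (coneFiber (tableau M1 e) ξ) := by
  rw [polarRank, hM1.polarSet_eq he hξ, Submodule.span_eq, finrank_comap_mkQ_baseChange,
    finrank_hyperplane e.finrank_plane hξ, e.finrank_plane]
  push_cast
  ring

/-- `Set.finrank` is the dimension of the span, and the set is already a subspace. -/
theorem IsFirstProlongation.finrank_coneFiber_eq {I : System m M}
    {Ω : Option (FormField m M (n + 1))} {M1 : Set (Gr m (n + 1) M)}
    (hM1 : IsFirstProlongation I Ω M1) {e : Gr m (n + 1) M} (he : e ∈ M1)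
    {ξ : Module.Dual ℂ (ℂ ⊗[ℝ] e.plane)} (hξ : ξ ≠ 0) :
    (Set.finrank ℂ {w | ξ.smulRight w ∈ complexTableau (tableau M1 e)} : ℤ) =
      polarRank (n + 1) I (hyperplane ξ) := by
  rw [hM1.polarRank_eq he hξ]
  exact congrArg (fun F : Submodule ℂ _ => (Module.finrank ℂ F : ℤ))
    (Submodule.span_eq (coneFiber (tableau M1 e) ξ))

theorem IsFirstProlongation.mem_characteristicVariety_iff {I : System m M}
    {Ω : Option (FormField m M (n + 1))} {M1 : Set (Gr m (n + 1) M)}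
    (hM1 : IsFirstProlongation I Ω M1) {e : Gr m (n + 1) M} (he : e ∈ M1)
    {ξ : Module.Dual ℂ (ℂ ⊗[ℝ] e.plane)} (hξ : ξ ≠ 0) :
    0 < polarRank (n + 1) I (hyperplane ξ) ↔
      ∃ w, w ≠ 0 ∧ ξ.smulRight w ∈ rankOneCone (tableau M1 e) := by
  rw [hM1.polarRank_eq he hξ, Nat.cast_pos, Module.finrank_pos_iff_exists_ne_zero]
  constructor
  · rintro ⟨⟨w, hw⟩, hw0⟩
    exact ⟨w, fun h => hw0 (Subtype.ext h), hw, w, ξ, rfl⟩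
  · rintro ⟨w, hw0, hw, -⟩
    exact ⟨⟨w, hw⟩, fun h => hw0 (congrArg Subtype.val h)⟩

end Characteristic

end EDS

end

theorem mainTheorem5 {m n : ℕ} {M : Type*} [TopologicalSpace M]
    [ChartedSpace (EDS.Model m) M] [IsManifold (𝓡 m) ∞ M]
    (I : EDS.System m M)
    (Ω : Option (EDS.FormField m M n)) (hΩ : ∀ η ∈ Ω, η.IsSmooth)
    (M1 : Set (EDS.Gr m n M)) (hM1 : EDS.IsFirstProlongation I Ω M1)
    (e : EDS.Gr m n M) (he : e ∈ M1) :
    -- an integral extension `f` of the hyperplane `ker ξ`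
    (∀ (ξ : Module.Dual ℝ e.plane) (f : EDS.GrFiber m n e.base)
        (w : TangentSpace (𝓡 m) e.base), ξ ≠ 0 →
        EDS.IsIntegralElement I f.toGr →
        f.1 = (LinearMap.ker ξ).map e.plane.subtype ⊔ Submodule.span ℝ {w} →
      ξ.smulRight (e.plane.mkQ w) ∈ EDS.tableau M1 e ∧
      (f.1 ≠ e.plane →
        EDS.Represents e.plane f.1 (ξ.smulRight (e.plane.mkQ w)) ∧
        ∃ ε > (0 : ℝ), ∃ γ : ℝ → EDS.GrFiber m n e.base,
          EDS.HasVelocity e γ (ξ.smulRight (e.plane.mkQ w)) ∧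
          ContinuousOn (fun t => (γ t).toGr) (Set.Ioo (-ε) ε) ∧
          Set.InjOn γ (Set.Ioo (-ε) ε) ∧
          ∀ t ∈ Set.Ioo (-ε) ε, (γ t).toGr ∈ M1 ∧
            (LinearMap.ker ξ).map e.plane.subtype ≤ (γ t).1 ∧
            (t ≠ 0 → EDS.Represents e.plane (γ t).1 (ξ.smulRight (e.plane.mkQ w))))) ∧
    -- the fiber of the rank-one cone over a complex covector `ξ`
    (∀ ξ : Module.Dual ℂ (ℂ ⊗[ℝ] e.plane), ξ ≠ 0 →
      {w | ξ.smulRight w ∈ EDS.complexTableau (EDS.tableau M1 e)} =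
          (e.plane.mkQ.baseChange ℂ) '' EDS.polarSet n I (EDS.hyperplane ξ) ∧
      (Set.finrank ℂ {w | ξ.smulRight w ∈ EDS.complexTableau (EDS.tableau M1 e)} : ℤ) =
          EDS.polarRank n I (EDS.hyperplane ξ)) ∧
    -- the characteristic variety is the projection of the rank-one cone
    EDS.characteristicVariety I e =
      {ξ | ξ ≠ 0 ∧ ∃ w, w ≠ 0 ∧ ξ.smulRight w ∈ EDS.rankOneCone (EDS.tableau M1 e)} := by
  -- For `n = 0` the plane is zero and carries no nonzero covector, so all assertions are empty.
  -- Otherwise the degree is a successor, as the adapted bases require.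
  obtain _ | n := n
  · have h1 : Subsingleton e.plane := Module.finrank_zero_iff.1 e.finrank_plane
    have h2 : Subsingleton (ℂ ⊗[ℝ] e.plane) := inferInstance
    refine ⟨fun ξ _ _ hξ => absurd (Subsingleton.elim ξ 0) hξ,
      fun ξ hξ => absurd (Subsingleton.elim ξ 0) hξ, ?_⟩
    ext ξ
    exact ⟨fun h => absurd (Subsingleton.elim ξ 0) h.1, fun h => absurd (Subsingleton.elim ξ 0) h.1⟩
  · refine ⟨fun ξ f w hξ hint hf => hM1.polar_extension he hξ hint hf, fun ξ hξ => ⟨?_, ?_⟩, ?_⟩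
    · exact (hM1.image_polarSet he hξ).symm
    · exact hM1.finrank_coneFiber_eq he hξ
    · ext ξ
      exact and_congr_right fun hξ => hM1.mem_characteristicVariety_iff he hξ
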